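/- Let $\gamma, R > 0$, $d, T \in \mathbb{N} = \{1,2,\dots\}$, $\delta \in (0,1/4]$, let $\mathcal{X} \subseteq \mathbb{R}^d$ be closed and convex with $\{x : \|x\|_2 \le R\} \subseteq \mathcal{X}$, and let $\mathcal{Y}$ be a measurable space. For a probability measure $P$ on $\mathcal{Y}$, let $\mathcal{F}(P,\gamma)$ be the set of functions $f : \mathbb{R}^d \times \mathcal{Y} \to \mathbb{R}$ such that $f(x,\cdot)$ is measurable for every $x \in \mathbb{R}^d$ and $P$-integrable for every $x \in \mathcal{X}$; $f(\cdot,y)$ is convex on $\mathbb{R}^d$ for every $y \in \mathcal{Y}$; and $\sup_{x \in \mathcal{X}} \mathbb{E}_P \|g_x(Y)\|_2^2 \le \gamma^2$, where $g_x(y)$ is the element of minimal Euclidean norm of the subdifferential of $f(\cdot,y)$ at $x$. Write $F_P(x) = \mathbb{E}_P f(x,Y)$ and $L^{\mathsf{opt}}(x;P,f) = F_P(x) - \inf_{x' \in \mathcal{X}} F_P(x')$, and let $\mathcal{G}(\gamma,R)$ be the set of pairs $(P,f)$ with $f \in \mathcal{F}(P,\gamma)$ such that $F_P$ has a minimiser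 $x^\star$ over $\mathcal{X}$ with $\|x^\star\|_2 \le R$. A procedure with known objective assigns to each $f$ occurring in $\mathcal{G}(\gamma,R)$ a measurable map $\widehat{x}_f : \mathcal{Y}^T \to \mathcal{X}$ (it knows $f$, but not $P$). It is a sample-function procedure if $\widehat{x}_f(y_1,\dots,y_T)$ depends on $f$ and $y_1,\dots,y_T$ only through the functions $f(\cdot,y_1),\dots,f(\cdot,y_T)$. For $\mathcal{A}$ equal to either of these two classes of procedures (which may depend on $\delta$), let $$\mathcal{M}^{\mathsf{opt}}_{\mathcal{A}}(\delta;T) = \inf_{\widehat{x} \in \mathcal{A}}\ \sup_{(P,f) \in \mathcal{G}(\gamma,R)}\ \inf\Bigl\{ r \in [0,\infty) : P^{\otimes T}\bigl\{ L^{\mathsf{opt}}(\widehat{x}_f;P,f) \le r \bigr\} \ge 1-\delta \Bigr\}.$$ Then there are universal constants $c, C > 0$ such that, for both choices of $\mathcal{A}$ and for all $d, T, \gamma, R, \delta, \mathcal{X}, \mathcal{Y}$ as above, $$\mathcal{M}^{\mathsf{opt}}_{\mathcal{A}}(\delta;T) \le C\, \gamma R \cdot \Bigl\{ \sqrt{\tfrac{\log(1/\delta)}{T}}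 \wedge 1 \Bigr\},$$ and, provided that the $\sigma$-algebra of $\mathcal{Y}$ is non-trivial (contains a set other than $\emptyset$ and $\mathcal{Y}$), $$\mathcal{M}^{\mathsf{opt}}_{\mathcal{A}}(\delta;T) \ge c\, \gamma R \cdot \Bigl\{ \sqrt{\tfrac{\log(1/\delta)}{T}} \wedge 1 \Bigr\}.$$ -/

import Mathlib

open MeasureTheory Set
open scoped ENNReal NNReal

noncomputable section

namespace StochOpt

/-- Euclidean space `ℝ^d`. -/
abbrev E (d : ℕ) : Type := EuclideanSpace ℝ (Fin d)

/-- The subdifferential at `x` of a function `φ : ℝ^d → ℝ`. -/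
def subdifferential {d : ℕ} (φ : E d → ℝ) (x : E d) : Set (E d) :=
  {v | ∀ z : E d, φ x + inner ℝ v (z - x) ≤ φ z}

/-- `v` is an element of minimal Euclidean norm of the subdifferential of `φ` at `x`. -/
def IsMinNormSubgradient {d : ℕ} (φ : E d → ℝ) (x v : E d) : Prop :=
  v ∈ subdifferential φ x ∧ ∀ w ∈ subdifferential φ x, ‖v‖ ≤ ‖w‖

/-- The subgradient of minimal Euclidean norm of `φ` at `x`. For convex `φ` it exists and is unique,
see `isMinNormSubgradient_iff`. -/
def minNormSubgradient {d : ℕ} (φ : E d → ℝ) (x : E d) : E d :=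
  Classical.epsilon (IsMinNormSubgradient φ x)

/-- A convex function on `ℝ^d` has a subgradient at every point. -/
theorem subdifferential_nonempty {d : ℕ} {φ : E d → ℝ} (hφ : ConvexOn ℝ univ φ) (x : E d) :
    (subdifferential φ x).Nonempty := by
  have hcont : Continuous φ :=
    continuousOn_univ.1 (hφ.continuousOn isOpen_univ)
  have hopen : IsOpen {p : E d × ℝ | φ p.1 < p.2} :=
    isOpen_lt (hcont.comp continuous_fst) continuous_snd
  have hconv : Convex ℝ {p : E d × ℝ | φ p.1 < p.2} := by
    simpa using hφ.convex_strict_epigraph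
  obtain ⟨ℓ, hℓ⟩ := geometric_hahn_banach_open_point hconv hopen
    (x := (x, φ x)) (by simp)
  set L : E d →L[ℝ] ℝ := ℓ.comp (ContinuousLinearMap.inl ℝ (E d) ℝ) with hL
  set α : ℝ := ℓ (0, 1) with hα
  have hsplit : ∀ (z : E d) (t : ℝ), ℓ (z, t) = L z + t * α := by
    intro z t
    have h1 : (z, t) = ((z, 0) : E d × ℝ) + t • ((0, 1) : E d × ℝ) := by
      simp
    rw [h1, map_add, map_smul]
    simp [hL, hα]
  have hαneg : α < 0 := by
    have h := hℓ (x, φ x + 1) (by simp)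
    rw [hsplit, hsplit] at h
    linarith
  have hle : ∀ z : E d, L z + φ z * α ≤ L x + φ x * α := by
    intro z
    refine le_of_forall_pos_le_add fun ε hε => ?_
    have h := hℓ (z, φ z + ε / (-α)) (by
      have : 0 < ε / (-α) := div_pos hε (by linarith)
      simpa using this)
    rw [hsplit, hsplit] at h
    have h2 : ε / (-α) * α = -ε := by
      rw [div_mul_eq_mul_div, div_eq_iff (by linarith)]
      ring
    nlinarith
  refine ⟨(InnerProductSpace.toDual ℝ (E d)).symm ((-α)⁻¹ • L), fun z => ?_⟩
  rw [InnerProductSpace.toDual_symm_apply]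
  have h := hle z
  have h3 : ((-α)⁻¹ • L) (z - x) = (L z - L x) / (-α) := by
    simp [div_eq_inv_mul]
  rw [h3]
  have h4 : (L z - L x) / (-α) ≤ φ z - φ x := by
    rw [div_le_iff₀ (by linarith)]
    nlinarith
  linarith

/-- For convex `φ`, the minimal-norm subgradient exists and is unique. -/
theorem isMinNormSubgradient_iff {d : ℕ} {φ : E d → ℝ} (hφ : ConvexOn ℝ univ φ) (x v : E d) :
    IsMinNormSubgradient φ x v ↔ v = minNormSubgradient φ x := by
  have hclosed : IsClosed (subdifferential φ x) := by
    have : subdifferential φ x = ⋂ z : E d, {v | φ x + inner ℝ v (z - x) ≤ φ z} := by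
      ext v; simp [subdifferential]
    rw [this]
    exact isClosed_iInter fun z => isClosed_le (by fun_prop) continuous_const
  have hconv : Convex ℝ (subdifferential φ x) := by
    intro v hv w hw a b ha hb hab z
    have h1 := mul_le_mul_of_nonneg_left (hv z) ha
    have h2 := mul_le_mul_of_nonneg_left (hw z) hb
    have h3 : φ x = a * φ x + b * φ x := by rw [← add_mul, hab, one_mul]
    have h4 : φ z = a * φ z + b * φ z := by rw [← add_mul, hab, one_mul]
    rw [inner_add_left, real_inner_smul_left, real_inner_smul_left]
    linarith
  have hex : ∃ v, IsMinNormSubgradient φ x v := by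
    obtain ⟨v, hv, hmin⟩ := hclosed.exists_infDist_eq_dist (subdifferential_nonempty hφ x) 0
    refine ⟨v, hv, fun w hw => ?_⟩
    have := Metric.infDist_le_dist_of_mem (x := (0 : E d)) hw
    rw [hmin] at this
    simpa [dist_eq_norm] using this
  have hspec : IsMinNormSubgradient φ x (minNormSubgradient φ x) := Classical.epsilon_spec hex
  refine ⟨fun h => ?_, fun h => h ▸ hspec⟩
  set w := minNormSubgradient φ x
  have hn : ‖v‖ = ‖w‖ := le_antisymm (h.2 w hspec.1) (hspec.2 v h.1)
  have hm := hconv h.1 hspec.1 (by norm_num : (0 : ℝ) ≤ 1 / 2) (by norm_num : (0 : ℝ) ≤ 1 / 2)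
    (by norm_num)
  have h5 := h.2 _ hm
  rw [← smul_add, norm_smul] at h5
  have h6 : 2 * ‖v‖ ≤ ‖v + w‖ := by
    rw [Real.norm_of_nonneg (by norm_num)] at h5; linarith
  have h7 := parallelogram_law_with_norm ℝ v w
  have h8 : ‖v - w‖ * ‖v - w‖ ≤ 0 := by
    rw [← hn] at h7
    nlinarith [norm_nonneg v]
  have h9 : ‖v - w‖ = 0 := by nlinarith [norm_nonneg (v - w)]
  exact sub_eq_zero.1 (norm_eq_zero.1 h9)

/-- The class `𝓕(P, γ)` of objectives: `f x y` is measurable in `y`, `P`-integrable in `y` for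
`x ∈ 𝒳`, convex in `x`, and `sup_{x ∈ 𝒳} E_P ‖g_x(Y)‖² ≤ γ²`, where `g_x(y)` is the minimal-norm
subgradient of `f(·, y)` at `x`. -/
structure IsObjective {d : ℕ} {𝒴 : Type*} [MeasurableSpace 𝒴] (𝒳 : Set (E d))
    (P : ProbabilityMeasure 𝒴) (γ : ℝ) (f : E d → 𝒴 → ℝ) : Prop where
  measurable : ∀ x, Measurable (f x)
  integrable : ∀ x ∈ 𝒳, Integrable (f x) (P : Measure 𝒴)
  convex : ∀ y, ConvexOn ℝ univ (fun x => f x y)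
  moment : ∀ x ∈ 𝒳,
    ∫⁻ y, ‖minNormSubgradient (fun x' => f x' y) x‖ₑ ^ 2 ∂(P : Measure 𝒴) ≤ ENNReal.ofReal (γ ^ 2)

/-- The population objective `F_P(x) = E_P f(x, Y)`. -/
def population {d : ℕ} {𝒴 : Type*} [MeasurableSpace 𝒴]
    (P : ProbabilityMeasure 𝒴) (f : E d → 𝒴 → ℝ) (x : E d) : ℝ :=
  ∫ y, f x y ∂(P : Measure 𝒴)

/-- The optimality gap `F_P(x) - inf_{x' ∈ 𝒳} F_P(x')`. -/
def optGap {d : ℕ} {𝒴 : Type*} [MeasurableSpace 𝒴] (𝒳 : Set (E d))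
    (P : ProbabilityMeasure 𝒴) (f : E d → 𝒴 → ℝ) (x : E d) : ℝ :=
  population P f x - sInf (population P f '' 𝒳)

/-- The class `𝓖(γ, R)` of problem instances `(P, f)`: `f ∈ 𝓕(P, γ)` and `F_P` has a minimiser over
`𝒳` of norm at most `R`. -/
def instances {d : ℕ} (𝒳 : Set (E d)) (𝒴 : Type*) [MeasurableSpace 𝒴] (γ R : ℝ) :
    Set (ProbabilityMeasure 𝒴 × (E d → 𝒴 → ℝ)) :=
  {p | IsObjective 𝒳 p.1 γ p.2 ∧
    ∃ x ∈ 𝒳, IsMinOn (population p.1 p.2) 𝒳 x ∧ ‖x‖ ≤ R}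

/-- The `(1 - δ)`-quantile `inf {r ∈ [0, ∞) : μ {L ≤ r} ≥ 1 - δ}` of a loss `L` under `μ`. -/
def quantile {Ω : Type*} [MeasurableSpace Ω] (δ : ℝ) (μ : Measure Ω) (L : Ω → ℝ) : ℝ≥0∞ :=
  ⨅ (r : ℝ≥0) (_ : ENNReal.ofReal (1 - δ) ≤ μ {ω | L ω ≤ r}), (r : ℝ≥0∞)

/-- `T`-sample procedures with known objective: to every `f` occurring in `𝓖(γ, R)`, a procedure
assigns a measurable map from `𝒴^T` to `𝒳`. The distribution `P` is not an argument.
The values at other `f` are irrelevant. -/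
def procedures {d : ℕ} (𝒳 : Set (E d)) (𝒴 : Type*) [MeasurableSpace 𝒴] (γ R : ℝ) (T : ℕ) :
    Set ((E d → 𝒴 → ℝ) → (Fin T → 𝒴) → E d) :=
  {xhat | ∀ p ∈ instances 𝒳 𝒴 γ R, Measurable (xhat p.2) ∧ ∀ y, xhat p.2 y ∈ 𝒳}

/-- Procedures that access `f` and the data only through the `T` sampled functions
`f(·, Y_1), …, f(·, Y_T)`, such as (projected, clipped) stochastic subgradient descent. -/
def sampleProcedures {d : ℕ} (𝒳 : Set (E d)) (𝒴 : Type*) [MeasurableSpace 𝒴] (γ R : ℝ) (T : ℕ) :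
    Set ((E d → 𝒴 → ℝ) → (Fin T → 𝒴) → E d) :=
  {xhat ∈ procedures 𝒳 𝒴 γ R T |
    ∃ A : (Fin T → E d → ℝ) → E d, ∀ f y, xhat f y = A (fun t x => f x (y t))}

/-- The minimax `(1 - δ)`-quantile of the optimality gap after `T` samples over `𝓖(γ, R)`, for a
class `𝒜` of procedures. -/
def minimaxQuantile {d : ℕ} (𝒳 : Set (E d)) (𝒴 : Type*) [MeasurableSpace 𝒴] (γ R δ : ℝ) (T : ℕ)
    (𝒜 : Set ((E d → 𝒴 → ℝ) → (Fin T → 𝒴) → E d)) : ℝ≥0∞ :=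
  ⨅ xhat ∈ 𝒜, ⨆ p ∈ instances 𝒳 𝒴 γ R,
    quantile δ (Measure.pi fun _ : Fin T => (p.1 : Measure 𝒴))
      (fun y => optGap 𝒳 p.1 p.2 (xhat p.2 y))

/-- The rate `γ R {√(log(1/δ)/T) ∧ 1}`. -/
def rate (γ R δ : ℝ) (T : ℕ) : ℝ :=
  γ * R * min (Real.sqrt (Real.log (1 / δ) / T)) 1

end StochOpt

end

/-! Lower bound: the objectives `γ|x_i - R|` and `γ|x_i + R|` are mixed with probabilities `1/2 ±
Δ`, so that the tilt decides whether the minimiser is `R e_i` or `-R e_i`. Being on the wrong side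
of `x_i = 0` costs `2ΔγR`, so a procedure with smaller quantiles under both tilts would test the
sign of the tilt from `T` coin flips with both errors at most `δ`. A Hellinger-type inequality
(`testing_lower_bound`) excludes this for `Δ` of order `√(log(1/δ)/T) ∧ 1`.

Upper bound: if `log(1/δ) ≤ T`, average the iterates of subgradient descent with clipped
subgradients, projected onto the ball of radius `R`. The potential is `exp(θ‖x - z‖²)`, with `z` the
minimiser. Clipping keeps the exponent's change in one step bounded by 1, so `e^t ≤ 1 + t + t²`
applies and only second moments of subgradients enter; the clipping bias is also paid for by the
second moment. The potential thus shrinks in mean by a factor governed by the optimality gap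
(`lintegral_exp_sgdStep_le`). Iterating bounds an exponential moment of the sum of the gaps
(`lintegral_exp_sum_traj_le`), and Markov and Jensen finish. If `log(1/δ) > T`, the constant output
0 suffices.

Measurability of the minimal-norm subgradient is avoided: the algorithm uses `oracle`, a
near-minimal approximate subgradient selected from a countable dense set. -/

noncomputable section

namespace StochOpt

/-! ### The lower bound -/

/-- If two probability measures on a finite space have a constant product of point masses, then no
test distinguishes them with both errors at most `δ`, unless that product is small. -/
theorem testing_lower_bound {Ω : Type*} [Fintype Ω] [MeasurableSpace Ω]
    [MeasurableSingletonClass Ω] (μ ν : Measure Ω) [IsProbabilityMeasure μ]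
    [IsProbabilityMeasure ν] {c δ : ℝ} (hc : ∀ s, μ.real {s} * ν.real {s} = c ^ 2)
    (hδ0 : 0 < δ) (hδ : δ ≤ 1 / 2) (A : Set Ω) (hμ : 1 - δ ≤ μ.real A) (hν : 1 - δ ≤ ν.real Aᶜ) :
    (Fintype.card Ω * c) ^ 2 ≤ 4 * δ * (1 - δ) := by
  classical
  set K := Real.sqrt (δ * (1 - δ)) with hK
  have hK2 : K ^ 2 = δ * (1 - δ) := Real.sq_sqrt (mul_nonneg hδ0.le (by linarith))
  have hKpos : 0 < K := Real.sqrt_pos.2 (mul_pos hδ0 (by linarith))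
  -- Weighted AM-GM. It is summed with weight `δ` on the measure for which the test is correct at
  -- `s` and `1 - δ` on the other. As both errors are at most `δ ≤ 1/2`, the total is at most `4δ(1
  -- - δ) = 4K²`.
  have amgm : ∀ x y : ℝ, 0 ≤ x → 0 ≤ y → x * y = c ^ 2 →
      2 * K * |c| ≤ δ * x + (1 - δ) * y := by
    intro x y hx hy hxy
    have h1 : 0 ≤ δ * x + (1 - δ) * y :=
      add_nonneg (mul_nonneg hδ0.le hx) (mul_nonneg (by linarith) hy)
    refine le_of_sq_le_sq ?_ h1
    have h2 : (2 * K * |c|) ^ 2 = 4 * (δ * (1 - δ)) * (x * y) := by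
      rw [hxy, ← hK2, mul_pow, mul_pow, sq_abs]; ring
    rw [h2]
    nlinarith [sq_nonneg (δ * x - (1 - δ) * y)]
  have hsum : ∀ (ρ : Measure Ω) [IsProbabilityMeasure ρ] (B : Set Ω),
      ρ.real B = ∑ s, if s ∈ B then ρ.real {s} else 0 := by
    intro ρ _ B
    rw [← Finset.sum_filter, sum_measureReal_singleton]
    congr 1; ext; simp
  have hmain : ∑ _s : Ω, 2 * K * |c| ≤
      δ * (μ.real A + ν.real Aᶜ) + (1 - δ) * (ν.real A + μ.real Aᶜ) := by
    rw [hsum μ A, hsum ν Aᶜ, hsum ν A, hsum μ Aᶜ, ← Finset.sum_add_distrib,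
      ← Finset.sum_add_distrib, Finset.mul_sum, Finset.mul_sum, ← Finset.sum_add_distrib]
    refine Finset.sum_le_sum fun s _ => ?_
    by_cases hs : s ∈ A
    · simpa [hs] using amgm _ _ measureReal_nonneg measureReal_nonneg (hc s)
    · simpa [hs] using amgm (ν.real {s}) (μ.real {s}) measureReal_nonneg measureReal_nonneg
        (by rw [mul_comm]; exact hc s)
  rw [probReal_compl_eq_one_sub A.toFinite.measurableSet] at hν hmain
  rw [probReal_compl_eq_one_sub A.toFinite.measurableSet] at hmain
  simp only [Finset.sum_const, Finset.card_univ, nsmul_eq_mul] at hmain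
  have h3 : Fintype.card Ω * |c| ≤ 2 * K := by
    have : K * (Fintype.card Ω * |c|) ≤ K * (2 * K) := by nlinarith
    exact le_of_mul_le_mul_left this hKpos
  have h4 := pow_le_pow_left₀ (by positivity) h3 2
  rw [mul_pow, sq_abs] at h4
  rw [mul_pow]
  linarith [mul_pow 2 K 2]

/-! ### Two-point measures and testing between them -/

/-- The measure with mass `p` at `a` and `1 - p` at `b`. -/
def twoPoint {𝒴 : Type*} [MeasurableSpace 𝒴] (a b : 𝒴) (p : ℝ) : Measure 𝒴 :=
  ENNReal.ofReal p • Measure.dirac a + ENNReal.ofReal (1 - p) • Measure.dirac b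

theorem isProbabilityMeasure_twoPoint {𝒴 : Type*} [MeasurableSpace 𝒴] (a b : 𝒴) {p : ℝ}
    (h0 : 0 ≤ p) (h1 : p ≤ 1) : IsProbabilityMeasure (twoPoint a b p) := by
  constructor
  simp [twoPoint, ← ENNReal.ofReal_add h0 (sub_nonneg.2 h1)]

theorem map_twoPoint {𝒴 𝒵 : Type*} [MeasurableSpace 𝒴] [MeasurableSpace 𝒵] (a b : 𝒴) (p : ℝ)
    {g : 𝒴 → 𝒵} (hg : Measurable g) : (twoPoint a b p).map g = twoPoint (g a) (g b) p := by
  simp [twoPoint, Measure.map_add _ _ hg, Measure.map_dirac' hg]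

theorem integral_twoPoint {𝒴 : Type*} [MeasurableSpace 𝒴] (a b : 𝒴) {p : ℝ}
    (h0 : 0 ≤ p) (h1 : p ≤ 1) {g : 𝒴 → ℝ} (hg : Measurable g) :
    ∫ y, g y ∂(twoPoint a b p) = p * g a + (1 - p) * g b := by
  have hi : ∀ (q : ℝ) (y : 𝒴), Integrable g (ENNReal.ofReal q • Measure.dirac y) := fun q y =>
    Integrable.smul_measure (integrable_dirac' hg.stronglyMeasurable (by simp)) (by simp)
  rw [twoPoint, integral_add_measure (hi _ _) (hi _ _), integral_smul_measure,
    integral_smul_measure, integral_dirac' _ _ hg.stronglyMeasurable,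
    integral_dirac' _ _ hg.stronglyMeasurable, ENNReal.toReal_ofReal h0,
    ENNReal.toReal_ofReal (sub_nonneg.2 h1)]
  simp

theorem integrable_twoPoint {𝒴 : Type*} [MeasurableSpace 𝒴] (a b : 𝒴) (p : ℝ) {g : 𝒴 → ℝ}
    (hg : Measurable g) : Integrable g (twoPoint a b p) := by
  have hi : ∀ (q : ℝ) (y : 𝒴), Integrable g (ENNReal.ofReal q • Measure.dirac y) := fun q y =>
    Integrable.smul_measure (integrable_dirac' hg.stronglyMeasurable (by simp)) (by simp)
  exact (hi _ _).add_measure (hi _ _)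

/-- From `T` samples, the two-point measures with masses `p` and `1 - p` at `a` cannot be told apart
with both errors at most `δ` when `(4 p (1 - p)) ^ T` is large. -/
theorem twoPoint_testing {𝒴 : Type*} [MeasurableSpace 𝒴] (a b : 𝒴) {p δ : ℝ} (T : ℕ)
    (h0 : 0 ≤ p) (h1 : p ≤ 1) (hδ0 : 0 < δ) (hδ : δ ≤ 1 / 2) (B : Set (Fin T → 𝒴))
    (hB : MeasurableSet B)
    (hμ : ENNReal.ofReal (1 - δ) ≤ Measure.pi (fun _ : Fin T => twoPoint a b p) B)
    (hν : ENNReal.ofReal (1 - δ) ≤ Measure.pi (fun _ : Fin T => twoPoint a b (1 - p)) Bᶜ) :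
    (4 * (p * (1 - p))) ^ T ≤ 4 * δ * (1 - δ) := by
  have hq0 : 0 ≤ 1 - p := by linarith
  have hq1 : 1 - p ≤ 1 := by linarith
  -- Both product measures are images of measures on the Boolean cube, which is finite with
  -- measurable singletons; `𝒴` need not be.
  set g : Bool → 𝒴 := fun s => bif s then a else b
  have hg : Measurable g := measurable_of_finite g
  set G : (Fin T → Bool) → (Fin T → 𝒴) := fun s t => g (s t)
  have hG : Measurable G := by fun_prop
  have i1 := isProbabilityMeasure_twoPoint true false h0 h1
  have i2 := isProbabilityMeasure_twoPoint true false hq0 hq1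
  have j1 := isProbabilityMeasure_twoPoint a b h0 h1
  have j2 := isProbabilityMeasure_twoPoint a b hq0 hq1
  have hpush : ∀ r : ℝ, IsProbabilityMeasure (twoPoint true false r) →
      IsProbabilityMeasure (twoPoint a b r) →
      Measure.pi (fun _ : Fin T => twoPoint a b r) =
        (Measure.pi (fun _ : Fin T => twoPoint true false r)).map G := by
    intro r _ _
    have hr : (twoPoint true false r).map g = twoPoint a b r := map_twoPoint _ _ _ hg
    have : ∀ _ : Fin T, SigmaFinite ((twoPoint true false r).map g) := fun _ => by
      rw [hr]; infer_instance
    rw [Measure.pi_map_pi (fun _ => hg.aemeasurable), hr]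
  rw [hpush p i1 j1, Measure.map_apply hG hB, ENNReal.ofReal_le_iff_le_toReal (by simp)] at hμ
  rw [hpush _ i2 j2, Measure.map_apply hG hB.compl, ENNReal.ofReal_le_iff_le_toReal (by simp)] at hν
  -- Replacing `p` by `1 - p` swaps the two masses, so each coordinate contributes `p(1 - p)` to the
  -- product of point masses, whatever the outcome.
  have key := testing_lower_bound (Measure.pi (fun _ : Fin T => twoPoint true false p))
    (Measure.pi (fun _ : Fin T => twoPoint true false (1 - p)))
    (c := Real.sqrt (p * (1 - p)) ^ T) ?_ hδ0 hδ (G ⁻¹' B) hμ hν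
  · have h2 : (Fintype.card (Fin T → Bool) * Real.sqrt (p * (1 - p)) ^ T) ^ 2 =
        (4 * (p * (1 - p))) ^ T := by
      simp only [Fintype.card_pi, Fintype.card_bool, Finset.prod_const, Finset.card_univ,
        Fintype.card_fin]
      push_cast
      rw [← mul_pow, ← pow_mul, mul_comm T 2, pow_mul, mul_pow, Real.sq_sqrt (mul_nonneg h0 hq0)]
      norm_num
    rwa [h2] at key
  · intro s
    rw [measureReal_def, measureReal_def, Measure.pi_singleton, Measure.pi_singleton,
      ENNReal.toReal_prod, ENNReal.toReal_prod, ← Finset.prod_mul_distrib, ← pow_mul, mul_comm T 2,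
      pow_mul, Real.sq_sqrt (mul_nonneg h0 hq0)]
    have : ∀ u : Bool, ((twoPoint true false p) {u}).toReal *
        ((twoPoint true false (1 - p)) {u}).toReal = p * (1 - p) := by
      intro u
      cases u <;> simp [twoPoint, h0, h1, mul_comm]
    simp [this]

/-! ### The hard instances -/

/-- Test the subgradient inequality at `x + v`: it forces growth `‖v‖²`, whereas the Lipschitz bound
allows only `γ‖v‖`. -/
theorem norm_le_of_mem_subdifferential {d : ℕ} {φ : E d → ℝ} {x v : E d} {γ : ℝ} (hγ : 0 ≤ γ)
    (hφ : ∀ z, φ z - φ x ≤ γ * ‖z - x‖) (hv : v ∈ subdifferential φ x) : ‖v‖ ≤ γ := by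
  by_contra! h
  have h1 := hv (x + v)
  have h2 := hφ (x + v)
  rw [add_sub_cancel_left, real_inner_self_eq_norm_sq] at h1
  rw [add_sub_cancel_left] at h2
  nlinarith

open Classical in
/-- The objective `γ |x_i - R|` on `S` and `γ |x_i + R|` off `S`. -/
def hardObjective {d : ℕ} {𝒴 : Type*} (i : Fin d) (S : Set 𝒴) (γ R : ℝ) : E d → 𝒴 → ℝ :=
  fun x y => if y ∈ S then γ * |x i - R| else γ * |x i + R|

theorem measurable_hardObjective {d : ℕ} {𝒴 : Type*} [MeasurableSpace 𝒴] (i : Fin d) {S : Set 𝒴}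
    (hS : MeasurableSet S) (γ R : ℝ) (x : E d) : Measurable (hardObjective i S γ R x) :=
  Measurable.ite hS measurable_const measurable_const

theorem convexOn_mul_abs_coord {d : ℕ} (i : Fin d) {γ : ℝ} (hγ : 0 ≤ γ) (r : ℝ) :
    ConvexOn ℝ univ (fun x : E d => γ * |x i + r|) := by
  refine ⟨convex_univ, fun x _ y _ a b ha hb hab => ?_⟩
  simp only [PiLp.add_apply, PiLp.smul_apply, smul_eq_mul]
  have h : a * x i + b * y i + r = a * (x i + r) + b * (y i + r) := by
    linear_combination (-r) * hab
  have h1 := abs_add_le (a * (x i + r)) (b * (y i + r))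
  rw [abs_mul, abs_mul, abs_of_nonneg ha, abs_of_nonneg hb] at h1
  rw [h]
  calc _ ≤ γ * (a * |x i + r| + b * |y i + r|) := mul_le_mul_of_nonneg_left h1 hγ
    _ = _ := by ring

theorem convexOn_hardObjective {d : ℕ} {𝒴 : Type*} (i : Fin d) (S : Set 𝒴) {γ : ℝ} (hγ : 0 ≤ γ)
    (R : ℝ) (y : 𝒴) : ConvexOn ℝ univ (fun x : E d => hardObjective i S γ R x y) := by
  by_cases hy : y ∈ S
  · simpa [hardObjective, hy, sub_eq_add_neg] using convexOn_mul_abs_coord i hγ (-R)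
  · simpa [hardObjective, hy] using convexOn_mul_abs_coord i hγ R

theorem hardObjective_sub_le {d : ℕ} {𝒴 : Type*} (i : Fin d) (S : Set 𝒴) {γ : ℝ} (hγ : 0 ≤ γ)
    (R : ℝ) (y : 𝒴) (x z : E d) :
    hardObjective i S γ R z y - hardObjective i S γ R x y ≤ γ * ‖z - x‖ := by
  have h := PiLp.norm_apply_le (z - x) i
  rw [PiLp.sub_apply, Real.norm_eq_abs] at h
  by_cases hy : y ∈ S
  · simp only [hardObjective, hy, if_true]
    have := abs_sub_abs_le_abs_sub (z i - R) (x i - R)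
    rw [show z i - R - (x i - R) = z i - x i by ring] at this
    nlinarith
  · simp only [hardObjective, hy, if_false]
    have := abs_sub_abs_le_abs_sub (z i + R) (x i + R)
    rw [show z i + R - (x i + R) = z i - x i by ring] at this
    nlinarith

theorem isObjective_hardObjective {d : ℕ} {𝒴 : Type*} [MeasurableSpace 𝒴] (𝒳 : Set (E d))
    (i : Fin d) {S : Set 𝒴} (hS : MeasurableSet S) {γ : ℝ} (hγ : 0 ≤ γ) (R : ℝ) (a b : 𝒴) (p : ℝ)
    (hp : IsProbabilityMeasure (twoPoint a b p)) :
    IsObjective 𝒳 ⟨twoPoint a b p, hp⟩ γ (hardObjective i S γ R) where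
  measurable x := measurable_hardObjective i hS γ R x
  integrable x _ := integrable_twoPoint a b p (measurable_hardObjective i hS γ R x)
  convex := convexOn_hardObjective i S hγ R
  moment x _ := by
    have hb : ∀ y, ‖minNormSubgradient (fun x' => hardObjective i S γ R x' y) x‖ₑ ^ 2 ≤
        ENNReal.ofReal (γ ^ 2) := by
      intro y
      have hm := ((isMinNormSubgradient_iff (convexOn_hardObjective i S hγ R y) x _).2 rfl).1
      have := norm_le_of_mem_subdifferential hγ (hardObjective_sub_le i S hγ R y x) hm
      rw [← ofReal_norm, ← ENNReal.ofReal_pow (norm_nonneg _)]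
      exact ENNReal.ofReal_le_ofReal (pow_le_pow_left₀ (norm_nonneg _) this 2)
    calc _ ≤ ∫⁻ _, ENNReal.ofReal (γ ^ 2) ∂(twoPoint a b p) := lintegral_mono hb
      _ = _ := by simp

theorem population_hardObjective {d : ℕ} {𝒴 : Type*} [MeasurableSpace 𝒴]
    (i : Fin d) {S : Set 𝒴} (hS : MeasurableSet S) (γ R : ℝ) {a b : 𝒴} (ha : a ∈ S)
    (hb : b ∉ S) {p : ℝ} (h0 : 0 ≤ p) (h1 : p ≤ 1) (hp : IsProbabilityMeasure (twoPoint a b p))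
    (x : E d) :
    population ⟨twoPoint a b p, hp⟩ (hardObjective i S γ R) x =
      γ * (p * |x i - R| + (1 - p) * |x i + R|) := by
  have := integral_twoPoint a b h0 h1 (measurable_hardObjective i hS γ R x)
  refine Eq.trans this ?_
  simp only [hardObjective, ha, hb, if_true, if_false]
  ring

/-- For `σ = ±1`, the tilted mixture of `|u - R|` and `|u + R|` is minimal at `σ R`, with linear
growth across the origin. -/
theorem tilted_abs_lower {R Δ σ u : ℝ} (hΔ0 : 0 ≤ Δ) (hΔ : Δ ≤ 1 / 2)
    (hσ : σ = 1 ∨ σ = -1) :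
    (1 - 2 * Δ) * R ≤ (1 / 2 + σ * Δ) * |u - R| + (1 - (1 / 2 + σ * Δ)) * |u + R| ∧
    (σ * u ≤ 0 → R ≤ (1 / 2 + σ * Δ) * |u - R| + (1 - (1 / 2 + σ * Δ)) * |u + R|) := by
  have h1 := le_abs_self (u - R)
  have h2 := neg_abs_le (u - R)
  have h3 := le_abs_self (u + R)
  have h4 := neg_abs_le (u + R)
  rcases hσ with rfl | rfl
  · constructor
    · nlinarith
    · intro hu
      nlinarith
  · constructor
    · nlinarith
    · intro hu
      nlinarith

/-- The minimiser is `σR e_i`, with value `γ(1 - 2Δ)R`; by `tilted_abs_lower` the value is at least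
`γR` on the wrong side of `x_i = 0`. -/
theorem hardObjective_mem_instances {d : ℕ} {𝒴 : Type*} [MeasurableSpace 𝒴] {𝒳 : Set (E d)}
    (i : Fin d) {S : Set 𝒴} (hS : MeasurableSet S) {γ R Δ σ : ℝ} (hγ : 0 < γ) (hR : 0 < R)
    (h𝒳 : Metric.closedBall 0 R ⊆ 𝒳) (hΔ0 : 0 ≤ Δ) (hΔ : Δ ≤ 1 / 2) (hσ : σ = 1 ∨ σ = -1)
    {a b : 𝒴} (ha : a ∈ S) (hb : b ∉ S)
    (hp : IsProbabilityMeasure (twoPoint a b (1 / 2 + σ * Δ))) :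
    ((⟨twoPoint a b (1 / 2 + σ * Δ), hp⟩, hardObjective i S γ R) :
        ProbabilityMeasure 𝒴 × (E d → 𝒴 → ℝ)) ∈ instances 𝒳 𝒴 γ R ∧
      ∀ x : E d, σ * x i ≤ 0 → 2 * Δ * γ * R ≤
        optGap 𝒳 ⟨twoPoint a b (1 / 2 + σ * Δ), hp⟩ (hardObjective i S γ R) x := by
  have h0 : 0 ≤ 1 / 2 + σ * Δ := by rcases hσ with rfl | rfl <;> linarith
  have h1 : 1 / 2 + σ * Δ ≤ 1 := by rcases hσ with rfl | rfl <;> linarith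
  have hpop := population_hardObjective (d := d) i hS γ R ha hb h0 h1 hp
  set xs : E d := EuclideanSpace.single i (σ * R) with hxs
  have hnorm : ‖xs‖ ≤ R := by
    rcases hσ with rfl | rfl <;> simp [hxs, abs_of_pos hR]
  have hmem : xs ∈ 𝒳 := h𝒳 (by simpa using hnorm)
  have hval : population ⟨twoPoint a b (1 / 2 + σ * Δ), hp⟩ (hardObjective i S γ R) xs =
      γ * ((1 - 2 * Δ) * R) := by
    rw [hpop]
    have : xs i = σ * R := by simp [hxs]
    rw [this]
    rcases hσ with rfl | rfl
    · rw [show 1 * R - R = 0 by ring, show 1 * R + R = 2 * R by ring, abs_zero,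
        abs_of_pos (by linarith)]
      ring
    · rw [show -1 * R - R = -(2 * R) by ring, show -1 * R + R = 0 by ring, abs_zero, abs_neg,
        abs_of_pos (by linarith)]
      ring
  have hmin : IsMinOn (population ⟨twoPoint a b (1 / 2 + σ * Δ), hp⟩
      (hardObjective i S γ R)) 𝒳 xs := by
    intro x _
    simp only [mem_ofPred_eq]
    rw [hval, hpop]
    exact mul_le_mul_of_nonneg_left (tilted_abs_lower hΔ0 hΔ hσ).1 hγ.le
  refine ⟨⟨isObjective_hardObjective 𝒳 i hS hγ.le R a b _ hp, xs, hmem, hmin, hnorm⟩, ?_⟩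
  intro x hx
  have hinf : sInf (population ⟨twoPoint a b (1 / 2 + σ * Δ), hp⟩
      (hardObjective i S γ R) '' 𝒳) = γ * ((1 - 2 * Δ) * R) := by
    rw [← hval]
    refine IsLeast.csInf_eq ⟨mem_image_of_mem _ hmem, ?_⟩
    rintro _ ⟨z, hz, rfl⟩
    exact hmin hz
  refine le_of_le_of_eq ?_ (congrArg₂ (· - ·) (hpop x) hinf).symm
  have := mul_le_mul_of_nonneg_left
    ((tilted_abs_lower (R := R) (u := x i) hΔ0 hΔ hσ).2 hx) hγ.le
  linarith

/-- With `L = log(1/δ)`, the right side is at least `exp(-8TΔ²) ≥ exp(-L/32) = δ^(1/32)`. If `δ <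
1/16`, this is at least `√δ > 4δ`. Otherwise `L ≤ 4 log 2` makes it exceed `9/10`, while `4δ(1 - δ)
≤ 3/4`. -/
theorem one_sub_four_mul_sq_pow_gt {δ : ℝ} {T : ℕ} (hT : 1 ≤ T) (hδ0 : 0 < δ) (hδ : δ ≤ 1 / 4)
    {Δ : ℝ} (hΔ : Δ = min (Real.sqrt (Real.log (1 / δ) / T)) 1 / 16) :
    4 * δ * (1 - δ) < (1 - 4 * Δ ^ 2) ^ T := by
  have hT0 : (0 : ℝ) < T := by exact_mod_cast hT
  set L := Real.log (1 / δ) with hL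
  have hL0 : 0 ≤ L := Real.log_nonneg (by rw [le_div_iff₀ hδ0]; linarith)
  have hexpL : Real.exp (-L) = δ := by
    rw [hL, one_div, Real.log_inv, neg_neg, Real.exp_log hδ0]
  have hm0 : 0 ≤ min (Real.sqrt (L / T)) 1 := le_min (Real.sqrt_nonneg _) zero_le_one
  have hsq1 : Δ ^ 2 ≤ 1 / 256 := by
    have := min_le_right (Real.sqrt (L / T)) 1
    rw [hΔ]; nlinarith
  have hsq2 : Δ ^ 2 ≤ L / T / 256 := by
    have h1 := min_le_left (Real.sqrt (L / T)) 1
    have h2 := pow_le_pow_left₀ hm0 h1 2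
    rw [Real.sq_sqrt (by positivity)] at h2
    rw [hΔ]; linarith [div_pow (min (Real.sqrt (L / T)) 1) 16 2]
  have hstep : Real.exp (-(8 * Δ ^ 2)) ≤ 1 - 4 * Δ ^ 2 := by
    rw [Real.exp_neg, inv_le_iff_one_le_mul₀ (Real.exp_pos _)]
    have := Real.add_one_le_exp (8 * Δ ^ 2)
    nlinarith [sq_nonneg Δ]
  have hpow : Real.exp (-(L / 32)) ≤ (1 - 4 * Δ ^ 2) ^ T := by
    refine le_trans ?_ (pow_le_pow_left₀ (Real.exp_pos _).le hstep T)
    rw [← Real.exp_nat_mul, Real.exp_le_exp]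
    have : (T : ℝ) * (8 * Δ ^ 2) ≤ T * (8 * (L / T / 256)) :=
      mul_le_mul_of_nonneg_left (by linarith) hT0.le
    have h2 : (T : ℝ) * (8 * (L / T / 256)) = L / 32 := by field_simp; ring
    linarith
  refine lt_of_lt_of_le ?_ hpow
  by_cases hcase : δ < 1 / 16
  · have h1 : Real.exp (-(L / 2)) ≤ Real.exp (-(L / 32)) := Real.exp_le_exp.2 (by linarith)
    have h2 : Real.exp (-(L / 2)) ^ 2 = δ := by
      rw [← Real.exp_nat_mul, ← hexpL]; congr 1; push_cast; ring
    have h3 := Real.exp_pos (-(L / 2))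
    have h4 : Real.exp (-(L / 2)) < 1 / 4 := by nlinarith
    have h5 : 4 * δ < Real.exp (-(L / 2)) := by nlinarith
    nlinarith
  · have h1 := Real.add_one_le_exp (-(L / 32))
    have h2 : L ≤ Real.log (2 ^ 4) :=
      Real.log_le_log (by positivity) (by rw [div_le_iff₀ hδ0]; linarith)
    rw [Real.log_pow] at h2
    push_cast at h2
    have h3 := Real.log_two_lt_d9
    nlinarith

/-- The sign of the output's coordinate `i` serves as the test. The constant is `2/16`, from the gap
`2ΔγR` and the factor `1/16` in `Δ`. -/
theorem minimaxQuantile_procedures_ge {d : ℕ} (hd : 1 ≤ d) {𝒴 : Type*} [MeasurableSpace 𝒴] {T : ℕ}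
    (hT : 1 ≤ T) {γ R δ : ℝ} (hγ : 0 < γ) (hR : 0 < R) (hδ0 : 0 < δ) (hδ : δ ≤ 1 / 4)
    {𝒳 : Set (E d)} (h𝒳 : Metric.closedBall 0 R ⊆ 𝒳)
    (hS : ∃ S : Set 𝒴, MeasurableSet S ∧ S.Nonempty ∧ Sᶜ.Nonempty) :
    ENNReal.ofReal (1 / 8 * rate γ R δ T) ≤
      minimaxQuantile 𝒳 𝒴 γ R δ T (procedures 𝒳 𝒴 γ R T) := by
  obtain ⟨S, hS, ⟨a, ha⟩, ⟨b, hb⟩⟩ := hS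
  set Δ := min (Real.sqrt (Real.log (1 / δ) / T)) 1 / 16 with hΔdef
  have hΔ0 : 0 ≤ Δ := by positivity
  have hΔ1 : Δ ≤ 1 / 2 := by
    have := min_le_right (Real.sqrt (Real.log (1 / δ) / T)) 1
    rw [hΔdef]; linarith
  have hrate : 1 / 8 * rate γ R δ T = 2 * Δ * γ * R := by rw [rate, hΔdef]; ring
  rw [hrate]
  let i : Fin d := ⟨0, hd⟩
  have hp : ∀ σ : ℝ, σ = 1 ∨ σ = -1 → IsProbabilityMeasure (twoPoint a b (1 / 2 + σ * Δ)) :=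
    fun σ hσ => isProbabilityMeasure_twoPoint a b
      (by rcases hσ with rfl | rfl <;> linarith) (by rcases hσ with rfl | rfl <;> linarith)
  have hinst := fun σ (hσ : σ = 1 ∨ σ = -1) =>
    hardObjective_mem_instances (𝒳 := 𝒳) i hS hγ hR h𝒳 hΔ0 hΔ1 hσ ha hb (hp σ hσ)
  refine le_iInf₂ fun xhat hx => ?_
  by_contra! hlt
  have hq : ∀ σ, (σ = 1 ∨ σ = -1) → ENNReal.ofReal (1 - δ) ≤
      Measure.pi (fun _ : Fin T => twoPoint a b (1 / 2 + σ * Δ))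
        {y | 0 < σ * xhat (hardObjective i S γ R) y i} := by
    intro σ hσ
    have h1 := lt_of_le_of_lt (le_iSup₂ (f := fun p (_ : p ∈ instances 𝒳 𝒴 γ R) =>
      quantile δ (Measure.pi fun _ : Fin T => (p.1 : Measure 𝒴))
      (fun y => optGap 𝒳 p.1 p.2 (xhat p.2 y))) _ (hinst σ hσ).1) hlt
    simp only [quantile, iInf_lt_iff] at h1
    obtain ⟨r, hr, hlt⟩ := h1
    refine hr.trans (measure_mono fun y hy => ?_)
    simp only [mem_ofPred_eq] at hy ⊢
    -- The infimum defining the quantile is strictly below `2ΔγR`, so some admissible `r` is too; an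
    -- output on the wrong side would have gap at least `2ΔγR > r`.
    by_contra! hneg
    have h2 := (hinst σ hσ).2 _ hneg
    rw [ENNReal.lt_ofReal_iff_toReal_lt (by simp)] at hlt
    simp only [ENNReal.coe_toReal] at hlt
    linarith
  have hm : Measurable fun y => xhat (hardObjective i S γ R) y i := by
    have := (hx _ (hinst 1 (Or.inl rfl)).1).1
    fun_prop
  have hB : MeasurableSet {y | 0 < xhat (hardObjective i S γ R) y i} :=
    measurableSet_lt measurable_const hm
  have h1 := hq 1 (Or.inl rfl)
  have h2 := hq (-1) (Or.inr rfl)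
  simp only [one_mul, neg_mul, Left.neg_pos_iff] at h1 h2
  have key := twoPoint_testing a b (p := 1 / 2 + Δ) T (by linarith) (by linarith) hδ0
    (by linarith) _ hB h1 (by
      rw [show 1 - (1 / 2 + Δ) = 1 / 2 + -Δ by ring]
      refine h2.trans (measure_mono fun y hy => ?_)
      simp only [mem_ofPred_eq, mem_compl_iff, not_lt] at hy ⊢
      exact hy.le)
  have h3 := one_sub_four_mul_sq_pow_gt hT hδ0 hδ hΔdef
  rw [show 4 * ((1 / 2 + Δ) * (1 - (1 / 2 + Δ))) = 1 - 4 * Δ ^ 2 by ring] at key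
  linarith

/-! ### Radial truncation -/

/-- Radial projection onto the ball of radius `r`; it serves as projection and as clipping. -/
def radialClip {d : ℕ} (r : ℝ) (x : E d) : E d := min 1 (r / ‖x‖) • x

theorem measurable_radialClip {d : ℕ} (r : ℝ) : Measurable (radialClip r : E d → E d) := by
  unfold radialClip
  fun_prop

theorem radialClip_of_norm_le {d : ℕ} {r : ℝ} {x : E d} (h : ‖x‖ ≤ r) : radialClip r x = x := by
  rcases eq_or_ne x 0 with rfl | hx
  · simp [radialClip]
  · rw [radialClip, min_eq_left, one_smul]
    rwa [one_le_div (norm_pos_iff.2 hx)]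

theorem radialClip_of_lt_norm {d : ℕ} {r : ℝ} (hr : 0 ≤ r) {x : E d} (h : r < ‖x‖) :
    radialClip r x = (r / ‖x‖) • x := by
  rw [radialClip, min_eq_right]
  exact (div_le_one (hr.trans_lt h)).2 h.le

theorem norm_radialClip_le {d : ℕ} {r : ℝ} (hr : 0 ≤ r) (x : E d) : ‖radialClip r x‖ ≤ r := by
  rcases le_or_gt ‖x‖ r with h | h
  · rwa [radialClip_of_norm_le h]
  · have hx : 0 < ‖x‖ := hr.trans_lt h
    rw [radialClip_of_lt_norm hr h, norm_smul, Real.norm_of_nonneg (by positivity),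
      div_mul_cancel₀ _ hx.ne']

theorem norm_radialClip_le_norm {d : ℕ} {r : ℝ} (hr : 0 ≤ r) (x : E d) :
    ‖radialClip r x‖ ≤ ‖x‖ := by
  rcases le_or_gt ‖x‖ r with h | h
  · rw [radialClip_of_norm_le h]
  · exact (norm_radialClip_le hr x).trans h.le

/-- With `s = r/‖x‖ ≤ 1` and `⟨x, z⟩ ≤ s‖x‖²`, the squared distance drops by at least `(1 -
s)²‖x‖²`. -/
theorem norm_radialClip_sub_le {d : ℕ} {r : ℝ} (hr : 0 ≤ r) (x : E d) {z : E d} (hz : ‖z‖ ≤ r) :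
    ‖radialClip r x - z‖ ≤ ‖x - z‖ := by
  rcases le_or_gt ‖x‖ r with h | h
  · rw [radialClip_of_norm_le h]
  · have hx : 0 < ‖x‖ := hr.trans_lt h
    rw [radialClip_of_lt_norm hr h]
    set s := r / ‖x‖ with hs
    have hs0 : 0 ≤ s := by positivity
    have hs1 : s ≤ 1 := (div_le_one hx).2 h.le
    have hrs : r = s * ‖x‖ := by rw [hs, div_mul_cancel₀ _ hx.ne']
    refine le_of_sq_le_sq ?_ (norm_nonneg _)
    rw [norm_sub_sq_real, norm_sub_sq_real, norm_smul, real_inner_smul_left,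
      Real.norm_of_nonneg hs0, mul_pow]
    have hin : inner ℝ x z ≤ s * ‖x‖ ^ 2 := by
      have := real_inner_le_norm x z
      have h2 := mul_le_mul_of_nonneg_left hz hx.le
      rw [hrs] at h2
      nlinarith
    have h3 : (1 - s) * inner ℝ x z ≤ (1 - s) * (s * ‖x‖ ^ 2) :=
      mul_le_mul_of_nonneg_left hin (by linarith)
    nlinarith [mul_nonneg (mul_nonneg (sub_nonneg.2 hs1) (sub_nonneg.2 hs1)) (sq_nonneg ‖x‖)]

/-- This is the clipping bias. It vanishes unless `‖x‖ > r`, and then it is at most `‖x‖ ≤ ‖x‖²/r`;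
hence a second moment controls it. -/
theorem norm_sub_radialClip_le {d : ℕ} {r : ℝ} (hr : 0 < r) (x : E d) :
    ‖x - radialClip r x‖ ≤ ‖x‖ ^ 2 / r := by
  rcases le_or_gt ‖x‖ r with h | h
  · rw [radialClip_of_norm_le h, sub_self, norm_zero]
    positivity
  · have hx : 0 < ‖x‖ := hr.trans h
    have hs1 : r / ‖x‖ ≤ 1 := (div_le_one hx).2 h.le
    have h1 : x - (r / ‖x‖) • x = (1 - r / ‖x‖) • x := by rw [sub_smul, one_smul]
    rw [radialClip_of_lt_norm hr.le h, h1, norm_smul, Real.norm_of_nonneg (by linarith)]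
    have h2 : (1 - r / ‖x‖) * ‖x‖ ≤ 1 * ‖x‖ :=
      mul_le_mul_of_nonneg_right (by linarith [div_nonneg hr.le hx.le]) hx.le
    refine h2.trans ?_
    rw [one_mul, le_div_iff₀ hr]
    nlinarith

/-! ### A measurable approximate minimal-norm subgradient -/

/-- `v` is a subgradient at `x`, up to an error `ε`, for comparison with points of norm `≤ R`. -/
def IsApproxSubgradient {d : ℕ} (R ε : ℝ) (φ : E d → ℝ) (x v : E d) : Prop :=
  ∀ z : Metric.closedBall (0 : E d) R, φ x + inner ℝ v (z - x) - ε ≤ φ z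

/-- The indices of a dense sequence that yield approximate subgradients of nearly minimal norm. -/
def oracleIndices {d : ℕ} (R ε γ : ℝ) (φ : E d → ℝ) (x : E d) : Set ℕ :=
  {k | IsApproxSubgradient R ε φ x (TopologicalSpace.denseSeq (E d) k) ∧
    ∀ j, IsApproxSubgradient R ε φ x (TopologicalSpace.denseSeq (E d) j) →
      ‖TopologicalSpace.denseSeq (E d) k‖ ≤ ‖TopologicalSpace.denseSeq (E d) j‖ + γ}

/-- An approximate subgradient of nearly minimal norm. -/
def oracle {d : ℕ} (R ε γ : ℝ) (φ : E d → ℝ) (x : E d) : E d :=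
  TopologicalSpace.denseSeq (E d) (sInf (oracleIndices R ε γ φ x))

/-- Comparison points are confined to a ball, so moving `g` by less than `ε/(R + ‖x‖ + 1)` changes
the linear term by less than `ε`. -/
theorem exists_isApproxSubgradient_denseSeq {d : ℕ} {R ε γ : ℝ} (hR : 0 ≤ R) (hε : 0 < ε)
    (hγ : 0 < γ) {φ : E d → ℝ} {x g : E d} (hg : g ∈ subdifferential φ x) :
    ∃ k, IsApproxSubgradient R ε φ x (TopologicalSpace.denseSeq (E d) k) ∧
      ‖TopologicalSpace.denseSeq (E d) k‖ ≤ ‖g‖ + γ := by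
  have hpos : 0 < R + ‖x‖ + 1 := by positivity
  obtain ⟨k, hk⟩ := (TopologicalSpace.denseRange_denseSeq (E d)).exists_dist_lt g
    (lt_min hγ (div_pos hε hpos))
  set v := TopologicalSpace.denseSeq (E d) k
  rw [dist_comm, dist_eq_norm, lt_min_iff, lt_div_iff₀ hpos] at hk
  refine ⟨k, fun z => ?_, ?_⟩
  · have hz : ‖(z : E d) - x‖ ≤ R + ‖x‖ + 1 := by
      have h1 := norm_sub_le (z : E d) x
      have h2 : ‖(z : E d)‖ ≤ R := mem_closedBall_zero_iff.1 z.2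
      linarith
    have h1 := real_inner_le_norm (v - g) ((z : E d) - x)
    have h2 := mul_le_mul_of_nonneg_left hz (norm_nonneg (v - g))
    have h3 := hg z
    rw [inner_sub_left] at h1
    linarith [hk.2]
  · have := norm_le_norm_add_norm_sub' v g
    linarith [hk.1]

theorem oracleIndices_nonempty {d : ℕ} {R ε γ : ℝ} (hR : 0 ≤ R) (hε : 0 < ε) (hγ : 0 < γ)
    {φ : E d → ℝ} (hφ : ConvexOn ℝ univ φ) (x : E d) : (oracleIndices R ε γ φ x).Nonempty := by
  obtain ⟨g, hg⟩ := subdifferential_nonempty hφ x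
  obtain ⟨k₀, hk₀, -⟩ := exists_isApproxSubgradient_denseSeq hR hε hγ hg
  set s : Set ℝ := (fun k => ‖TopologicalSpace.denseSeq (E d) k‖) ''
    {k | IsApproxSubgradient R ε φ x (TopologicalSpace.denseSeq (E d) k)} with hs
  have hne : s.Nonempty := ⟨_, k₀, hk₀, rfl⟩
  have hbdd : BddBelow s := ⟨0, by rintro _ ⟨k, -, rfl⟩; exact norm_nonneg _⟩
  obtain ⟨_, ⟨k, hk, rfl⟩, hlt⟩ := exists_lt_of_csInf_lt hne (lt_add_of_pos_right (sInf s) hγ)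
  exact ⟨k, hk, fun j hj => hlt.le.trans (by linarith [csInf_le hbdd ⟨j, hj, rfl⟩])⟩

theorem isApproxSubgradient_oracle {d : ℕ} {R ε γ : ℝ} (hR : 0 ≤ R) (hε : 0 < ε) (hγ : 0 < γ)
    {φ : E d → ℝ} (hφ : ConvexOn ℝ univ φ) (x : E d) :
    IsApproxSubgradient R ε φ x (oracle R ε γ φ x) :=
  (Nat.sInf_mem (oracleIndices_nonempty hR hε hγ hφ x)).1

/-- One `γ` pays for replacing the minimal-norm subgradient by a point of the dense sequence, the
other for the near-minimality in `oracleIndices`. -/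
theorem norm_oracle_le {d : ℕ} {R ε γ : ℝ} (hR : 0 ≤ R) (hε : 0 < ε) (hγ : 0 < γ)
    {φ : E d → ℝ} (hφ : ConvexOn ℝ univ φ) (x : E d) :
    ‖oracle R ε γ φ x‖ ≤ ‖minNormSubgradient φ x‖ + 2 * γ := by
  obtain ⟨j, hj, hjn⟩ := exists_isApproxSubgradient_denseSeq hR hε hγ
    ((isMinNormSubgradient_iff hφ x _).2 rfl).1
  have := (Nat.sInf_mem (oracleIndices_nonempty hR hε hγ hφ x)).2 j hj
  rw [oracle]
  linarith

section Measurability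

variable {d : ℕ} {𝒴 : Type*} [MeasurableSpace 𝒴] {f : E d → 𝒴 → ℝ}

theorem continuous_of_convexOn_univ {φ : E d → ℝ} (hφ : ConvexOn ℝ univ φ) : Continuous φ :=
  continuousOn_univ.1 (hφ.continuousOn isOpen_univ)

theorem measurable_uncurry_of_convex (hm : ∀ x, Measurable (f x))
    (hc : ∀ y, ConvexOn ℝ univ (fun x => f x y)) : Measurable (Function.uncurry f) :=
  measurable_uncurry_of_continuous_of_measurable
    (fun y => continuous_of_convexOn_univ (hc y)) hm

/-- Continuity of `f(·, y)` reduces the comparison points to a countable dense subset of the ball.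
-/
theorem measurableSet_isApproxSubgradient {R : ℝ} (hR : 0 ≤ R) (ε : ℝ)
    (hm : ∀ x, Measurable (f x)) (hc : ∀ y, ConvexOn ℝ univ (fun x => f x y)) (v : E d) :
    MeasurableSet {p : E d × 𝒴 | IsApproxSubgradient R ε (fun x => f x p.2) p.1 v} := by
  have : Nonempty (Metric.closedBall (0 : E d) R) := ⟨⟨0, by simpa using hR⟩⟩
  have hset : {p : E d × 𝒴 | IsApproxSubgradient R ε (fun x => f x p.2) p.1 v} =
      ⋂ k : ℕ, {p : E d × 𝒴 | f p.1 p.2 +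
        inner ℝ v (TopologicalSpace.denseSeq (Metric.closedBall (0 : E d) R) k - p.1) - ε ≤
        f (TopologicalSpace.denseSeq (Metric.closedBall (0 : E d) R) k) p.2} := by
    ext p
    simp only [mem_ofPred_eq, mem_iInter, IsApproxSubgradient]
    refine ⟨fun h k => h _, fun h z => ?_⟩
    have hcont := continuous_of_convexOn_univ (hc p.2)
    refine (TopologicalSpace.denseRange_denseSeq (Metric.closedBall (0 : E d) R)).induction_on
      (p := fun z => f p.1 p.2 + inner ℝ v ((z : E d) - p.1) - ε ≤ f z p.2) z ?_ h
    exact isClosed_le (by fun_prop) (hcont.comp continuous_subtype_val)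
  rw [hset]
  refine MeasurableSet.iInter fun k => measurableSet_le ?_ ((hm _).comp measurable_snd)
  have h1 : Measurable fun p : E d × 𝒴 => f p.1 p.2 := measurable_uncurry_of_convex hm hc
  fun_prop

/-- The oracle is a function of the least admissible index, and admissibility of each index is a
countable combination of measurable conditions. -/
theorem measurable_oracle {R ε γ : ℝ} (hR : 0 ≤ R) (hε : 0 < ε) (hγ : 0 < γ)
    (hm : ∀ x, Measurable (f x)) (hc : ∀ y, ConvexOn ℝ univ (fun x => f x y)) :
    Measurable fun p : E d × 𝒴 => oracle R ε γ (fun x => f x p.2) p.1 := by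
  classical
  have hne : ∀ p : E d × 𝒴, ∃ k, k ∈ oracleIndices R ε γ (fun x => f x p.2) p.1 :=
    fun p => oracleIndices_nonempty hR hε hγ (hc p.2) p.1
  have hfind : Measurable fun p : E d × 𝒴 => Nat.find (hne p) := by
    refine measurable_find hne fun k => ?_
    have hset : {p : E d × 𝒴 | k ∈ oracleIndices R ε γ (fun x => f x p.2) p.1} =
        {p : E d × 𝒴 | IsApproxSubgradient R ε (fun x => f x p.2) p.1
          (TopologicalSpace.denseSeq (E d) k)} ∩
        ⋂ j, ({p : E d × 𝒴 | IsApproxSubgradient R ε (fun x => f x p.2) p.1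
          (TopologicalSpace.denseSeq (E d) j)}ᶜ ∪
          {_p | ‖TopologicalSpace.denseSeq (E d) k‖ ≤ ‖TopologicalSpace.denseSeq (E d) j‖ + γ}) := by
      ext p
      simp [oracleIndices, imp_iff_not_or]
    rw [hset]
    exact (measurableSet_isApproxSubgradient hR ε hm hc _).inter
      (MeasurableSet.iInter fun j =>
        (measurableSet_isApproxSubgradient hR ε hm hc _).compl.union (MeasurableSet.const _))
  have heq : (fun p : E d × 𝒴 => oracle R ε γ (fun x => f x p.2) p.1) =
      fun p => TopologicalSpace.denseSeq (E d) (Nat.find (hne p)) := by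
    funext p
    rw [oracle, Nat.sInf_def (hne p)]
  rw [heq]
  exact (measurable_of_countable (TopologicalSpace.denseSeq (E d))).comp hfind

end Measurability

section Oracle

variable {d : ℕ} {𝒴 : Type*} [MeasurableSpace 𝒴] {𝒳 : Set (E d)} {P : ProbabilityMeasure 𝒴}
  {γ R ε : ℝ} {f : E d → 𝒴 → ℝ}

theorem lintegral_oracle_sq_le (hf : IsObjective 𝒳 P γ f) (hR : 0 ≤ R) (hε : 0 < ε) (hγ : 0 < γ)
    {x : E d} (hx : x ∈ 𝒳) :
    ∫⁻ y, ENNReal.ofReal (‖oracle R ε γ (fun x' => f x' y) x‖ ^ 2) ∂(P : Measure 𝒴) ≤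
      ENNReal.ofReal (10 * γ ^ 2) := by
  have hpt : ∀ y, ENNReal.ofReal (‖oracle R ε γ (fun x' => f x' y) x‖ ^ 2) ≤
      2 * ‖minNormSubgradient (fun x' => f x' y) x‖ₑ ^ 2 + ENNReal.ofReal (8 * γ ^ 2) := by
    intro y
    set g := minNormSubgradient (fun x' => f x' y) x
    have h := norm_oracle_le hR hε hγ (hf.convex y) x
    have h2 : 2 * ‖g‖ₑ ^ 2 = ENNReal.ofReal (2 * ‖g‖ ^ 2) := by
      rw [← ofReal_norm, ← ENNReal.ofReal_pow (norm_nonneg _), ENNReal.ofReal_mul (by norm_num)]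
      simp
    rw [h2, ← ENNReal.ofReal_add (by positivity) (by positivity)]
    refine ENNReal.ofReal_le_ofReal ((pow_le_pow_left₀ (norm_nonneg _) h 2).trans ?_)
    nlinarith [sq_nonneg (‖g‖ - 2 * γ)]
  calc _ ≤ ∫⁻ y, (2 * ‖minNormSubgradient (fun x' => f x' y) x‖ₑ ^ 2 +
        ENNReal.ofReal (8 * γ ^ 2)) ∂(P : Measure 𝒴) := lintegral_mono hpt
    _ = 2 * ∫⁻ y, ‖minNormSubgradient (fun x' => f x' y) x‖ₑ ^ 2 ∂(P : Measure 𝒴) +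
        ENNReal.ofReal (8 * γ ^ 2) := by
      -- Only the constant summand has to be measurable and the factor 2 finite, so the minimal-norm
      -- subgradient needs no measurability.
      rw [lintegral_add_right _ measurable_const, lintegral_const_mul' _ _ (by simp)]
      simp
    _ ≤ 2 * ENNReal.ofReal (γ ^ 2) + ENNReal.ofReal (8 * γ ^ 2) := by
      gcongr
      exact hf.moment x hx
    _ = _ := by
      rw [show (2 : ℝ≥0∞) = ENNReal.ofReal 2 by simp, ← ENNReal.ofReal_mul (by norm_num),
        ← ENNReal.ofReal_add (by positivity) (by positivity)]
      congr 1; ring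

theorem measurable_oracle_section (hf : IsObjective 𝒳 P γ f) (hR : 0 ≤ R) (hε : 0 < ε)
    (hγ : 0 < γ) (x : E d) : Measurable fun y => oracle R ε γ (fun x' => f x' y) x :=
  (measurable_oracle hR hε hγ hf.measurable hf.convex).comp
    (measurable_const.prodMk measurable_id)

theorem integrable_oracle_sq (hf : IsObjective 𝒳 P γ f) (hR : 0 ≤ R) (hε : 0 < ε) (hγ : 0 < γ)
    {x : E d} (hx : x ∈ 𝒳) :
    Integrable (fun y => ‖oracle R ε γ (fun x' => f x' y) x‖ ^ 2) (P : Measure 𝒴) := by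
  refine ⟨((measurable_oracle_section hf hR hε hγ x).norm.pow_const 2).aestronglyMeasurable, ?_⟩
  rw [hasFiniteIntegral_iff_ofReal (Filter.Eventually.of_forall fun y => by positivity)]
  exact (lintegral_oracle_sq_le hf hR hε hγ hx).trans_lt ENNReal.ofReal_lt_top

theorem integral_oracle_sq_le (hf : IsObjective 𝒳 P γ f) (hR : 0 ≤ R) (hε : 0 < ε) (hγ : 0 < γ)
    {x : E d} (hx : x ∈ 𝒳) :
    ∫ y, ‖oracle R ε γ (fun x' => f x' y) x‖ ^ 2 ∂(P : Measure 𝒴) ≤ 10 * γ ^ 2 := by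
  rw [integral_eq_lintegral_of_nonneg_ae (Filter.Eventually.of_forall fun y => by positivity)
    (integrable_oracle_sq hf hR hε hγ hx).aestronglyMeasurable]
  exact ENNReal.toReal_le_of_le_ofReal (by positivity) (lintegral_oracle_sq_le hf hR hε hγ hx)

/-! ### One step of clipped projected subgradient descent -/

/-- One step of clipped stochastic subgradient descent, projected onto the ball of radius `R`. -/
def sgdStep (R ε γ η lam : ℝ) (x : E d) (φ : E d → ℝ) : E d :=
  radialClip R (x - η • radialClip lam (oracle R ε γ φ x))

theorem norm_sgdStep_le (hR : 0 ≤ R) (η lam : ℝ) (x : E d) (φ : E d → ℝ) :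
    ‖sgdStep R ε γ η lam x φ‖ ≤ R := norm_radialClip_le hR _

/-- Pointwise bound on the exponential of the change of squared distance in one step. -/
theorem exp_sgdStep_le (hR : 0 ≤ R) (hε : 0 < ε) (hγ : 0 < γ) {η lam θ : ℝ} (hη : 0 < η)
    (hl : 0 < lam) (hθ : 0 < θ) (hηl : η * lam ≤ R) (hθl : θ * (5 * R * (η * lam)) ≤ 1)
    {φ : E d → ℝ} (hφ : ConvexOn ℝ univ φ) {x z : E d} (hx : ‖x‖ ≤ R) (hz : ‖z‖ ≤ R) :
    Real.exp (θ * ‖sgdStep R ε γ η lam x φ - z‖ ^ 2) ≤ Real.exp (θ * ‖x - z‖ ^ 2) *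
      (1 - 2 * η * θ * (φ x - φ z) + 2 * η * θ * ε +
        (4 * R * η * θ / lam + θ * η ^ 2 + 25 * θ ^ 2 * R ^ 2 * η ^ 2) *
          ‖oracle R ε γ φ x‖ ^ 2) := by
  set v := oracle R ε γ φ x with hv
  set w := radialClip lam v with hw
  set V := -(2 * η * inner ℝ w (x - z)) + η ^ 2 * ‖w‖ ^ 2 with hV
  have hxz : ‖x - z‖ ≤ 2 * R := (norm_sub_le x z).trans (by linarith)
  have hwl : ‖w‖ ≤ lam := norm_radialClip_le hl.le v
  have hwv : ‖w‖ ≤ ‖v‖ := norm_radialClip_le_norm hl.le v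
  have hsq : ‖sgdStep R ε γ η lam x φ - z‖ ^ 2 ≤ ‖x - z‖ ^ 2 + V := by
    have h1 := pow_le_pow_left₀ (norm_nonneg _)
      (norm_radialClip_sub_le hR (x - η • w) hz) 2
    have h2 : x - η • w - z = (x - z) - η • w := by abel
    have h3 : ‖(x - z) - η • w‖ ^ 2 = ‖x - z‖ ^ 2 + V := by
      rw [norm_sub_sq_real, norm_smul, real_inner_smul_right, Real.norm_of_nonneg hη.le,
        real_inner_comm, hV]
      ring
    rw [h2, h3] at h1
    exact h1
  -- The 5 is `4 + 1`: the cross term uses `‖x - z‖ ≤ 2R`, the quadratic one `η‖w‖ ≤ R`.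
  have hVabs : |V| ≤ 5 * R * η * ‖w‖ := by
    have h1 := abs_real_inner_le_norm w (x - z)
    have h2 := mul_le_mul_of_nonneg_left hxz (norm_nonneg w)
    have h3 : |V| ≤ 2 * η * |inner ℝ w (x - z)| + η ^ 2 * ‖w‖ ^ 2 := by
      refine (abs_add_le _ _).trans ?_
      rw [abs_neg, abs_mul, abs_of_pos (by positivity : 0 < 2 * η), abs_of_nonneg
        (by positivity : 0 ≤ η ^ 2 * ‖w‖ ^ 2)]
    have h4 : 2 * η * |inner ℝ w (x - z)| ≤ 2 * η * (‖w‖ * (2 * R)) :=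
      mul_le_mul_of_nonneg_left (h1.trans h2) (by positivity)
    have h5 : η * ‖w‖ ≤ R := (mul_le_mul_of_nonneg_left hwl hη.le).trans hηl
    have h6 := mul_le_mul_of_nonneg_left h5 (by positivity : 0 ≤ η * ‖w‖)
    linarith
  have hVsq : V ^ 2 ≤ 25 * R ^ 2 * η ^ 2 * ‖v‖ ^ 2 := by
    have h1 : |V| ≤ 5 * R * η * ‖v‖ :=
      hVabs.trans (mul_le_mul_of_nonneg_left hwv (by positivity))
    have h2 := pow_le_pow_left₀ (abs_nonneg V) h1 2
    rw [sq_abs] at h2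
    linarith [mul_pow (5 * R * η) ‖v‖ 2, mul_pow (5 * R) η 2, mul_pow 5 R 2]
  have hθV : |θ * V| ≤ 1 := by
    rw [abs_mul, abs_of_pos hθ]
    refine (mul_le_mul_of_nonneg_left (hVabs.trans ?_) hθ.le).trans hθl
    have := mul_le_mul_of_nonneg_left hwl (by positivity : 0 ≤ 5 * R * η)
    linarith
  -- The drift comes from the approximate subgradient inequality for `v`; passing to the clipped `w`
  -- costs the bias `‖v‖²/lam` times `2R`.
  have hVle : V ≤ -(2 * η * (φ x - φ z)) + 2 * η * ε + (4 * R * η / lam + η ^ 2) * ‖v‖ ^ 2 := by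
    have h1 := isApproxSubgradient_oracle hR hε hγ hφ x ⟨z, by simpa using hz⟩
    simp only [← hv] at h1
    have h2 := norm_sub_radialClip_le hl v
    rw [← hw] at h2
    have h3 := real_inner_le_norm (v - w) (x - z)
    have h4 := mul_le_mul h2 hxz (norm_nonneg _) (by positivity)
    rw [inner_sub_left] at h3
    have h5 : inner ℝ v (z - x) = -inner ℝ v (x - z) := by
      rw [← inner_neg_right, neg_sub]
    have h6 : -(inner ℝ w (x - z)) ≤ -(φ x - φ z) + ε + ‖v‖ ^ 2 / lam * (2 * R) := by linarith
    have h7 := mul_le_mul_of_nonneg_left h6 (by positivity : 0 ≤ 2 * η)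
    have h8 := mul_le_mul_of_nonneg_left (pow_le_pow_left₀ (norm_nonneg _) hwv 2)
      (sq_nonneg η)
    have h9 : 2 * η * (‖v‖ ^ 2 / lam * (2 * R)) = 4 * R * η / lam * ‖v‖ ^ 2 := by ring
    rw [hV]
    linarith
  have hexp : Real.exp (θ * V) ≤ 1 + θ * V + (θ * V) ^ 2 := by
    have := (abs_le.1 (Real.abs_exp_sub_one_sub_id_le hθV)).2
    linarith
  calc Real.exp (θ * ‖sgdStep R ε γ η lam x φ - z‖ ^ 2)
      ≤ Real.exp (θ * (‖x - z‖ ^ 2 + V)) :=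
        Real.exp_le_exp.2 (mul_le_mul_of_nonneg_left hsq hθ.le)
    _ = Real.exp (θ * ‖x - z‖ ^ 2) * Real.exp (θ * V) := by rw [mul_add, Real.exp_add]
    _ ≤ _ := by
      refine mul_le_mul_of_nonneg_left (hexp.trans ?_) (Real.exp_pos _).le
      have h1 := mul_le_mul_of_nonneg_left hVle hθ.le
      have h2 := mul_le_mul_of_nonneg_left hVsq (sq_nonneg θ)
      have h3 : 4 * R * η * θ / lam = θ * (4 * R * η / lam) := by ring
      rw [h3]
      linarith [mul_pow θ V 2]

/-- One step decreases the exponential moment of the squared distance to `z` by the optimality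
gap, up to an additive error in the exponent. -/
theorem lintegral_exp_sgdStep_le (hf : IsObjective 𝒳 P γ f) (h𝒳 : Metric.closedBall 0 R ⊆ 𝒳)
    (hR : 0 ≤ R) (hε : 0 < ε) (hγ : 0 < γ) {η lam θ : ℝ} (hη : 0 < η)
    (hl : 0 < lam) (hθ : 0 < θ) (hηl : η * lam ≤ R) (hθl : θ * (5 * R * (η * lam)) ≤ 1)
    {x z : E d} (hx : ‖x‖ ≤ R) (hz : ‖z‖ ≤ R) {K : ℝ}
    (hK : 2 * η * θ * ε + (4 * R * η * θ / lam + θ * η ^ 2 + 25 * θ ^ 2 * R ^ 2 * η ^ 2) *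
      (10 * γ ^ 2) ≤ K) :
    ∫⁻ y, ENNReal.ofReal (Real.exp (θ * ‖sgdStep R ε γ η lam x (fun x' => f x' y) - z‖ ^ 2))
        ∂(P : Measure 𝒴) ≤
      ENNReal.ofReal (Real.exp (θ * ‖x - z‖ ^ 2 -
        2 * η * θ * (population P f x - population P f z) + K)) := by
  have hx𝒳 : x ∈ 𝒳 := h𝒳 (by simpa using hx)
  have hz𝒳 : z ∈ 𝒳 := h𝒳 (by simpa using hz)
  set B := 4 * R * η * θ / lam + θ * η ^ 2 + 25 * θ ^ 2 * R ^ 2 * η ^ 2 with hB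
  have hB0 : 0 ≤ B := by positivity
  set bd : 𝒴 → ℝ := fun y => 1 - 2 * η * θ * (f x y - f z y) + 2 * η * θ * ε +
    B * ‖oracle R ε γ (fun x' => f x' y) x‖ ^ 2 with hbd
  have hpt : ∀ y, Real.exp (θ * ‖sgdStep R ε γ η lam x (fun x' => f x' y) - z‖ ^ 2) ≤
      Real.exp (θ * ‖x - z‖ ^ 2) * bd y := fun y =>
    exp_sgdStep_le hR hε hγ hη hl hθ hηl hθl (hf.convex y) hx hz
  have hi1 : Integrable (fun y => 2 * η * θ * (f x y - f z y)) (P : Measure 𝒴) :=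
    ((hf.integrable x hx𝒳).sub (hf.integrable z hz𝒳)).const_mul _
  have hi2 := (integrable_oracle_sq hf hR hε hγ hx𝒳).const_mul B
  have hi3 : Integrable (fun y => 1 - 2 * η * θ * (f x y - f z y)) (P : Measure 𝒴) :=
    (integrable_const _).sub hi1
  have hi4 : Integrable (fun y => 1 - 2 * η * θ * (f x y - f z y) + 2 * η * θ * ε)
    (P : Measure 𝒴) := hi3.add (integrable_const _)
  have hint : Integrable bd (P : Measure 𝒴) := hi4.add hi2
  -- Nonnegativity, needed to pass from the Lebesgue to the Bochner integral, follows because `bd`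
  -- times a positive factor dominates an exponential.
  have hbd0 : ∀ y, 0 ≤ bd y := fun y =>
    (pos_of_mul_pos_right ((Real.exp_pos _).trans_le (hpt y)) (Real.exp_pos _).le).le
  have hval : ∫ y, bd y ∂(P : Measure 𝒴) ≤
      Real.exp (-(2 * η * θ * (population P f x - population P f z)) + K) := by
    have h1 : ∫ y, bd y ∂(P : Measure 𝒴) =
        1 - 2 * η * θ * (population P f x - population P f z) + 2 * η * θ * ε +
          B * ∫ y, ‖oracle R ε γ (fun x' => f x' y) x‖ ^ 2 ∂(P : Measure 𝒴) := by
      rw [hbd, integral_add hi4 hi2, integral_add hi3 (integrable_const _),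
        integral_sub (integrable_const _) hi1, integral_const_mul,
        integral_sub (hf.integrable x hx𝒳) (hf.integrable z hz𝒳)]
      simp [population, integral_const_mul]
    rw [h1]
    have h2 := mul_le_mul_of_nonneg_left (integral_oracle_sq_le hf hR hε hγ hx𝒳) hB0
    have h3 := Real.add_one_le_exp
      (-(2 * η * θ * (population P f x - population P f z)) + K)
    linarith
  calc _ ≤ ∫⁻ y, ENNReal.ofReal (Real.exp (θ * ‖x - z‖ ^ 2)) * ENNReal.ofReal (bd y)
        ∂(P : Measure 𝒴) := by
        refine lintegral_mono fun y => ?_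
        rw [← ENNReal.ofReal_mul (Real.exp_pos _).le]
        exact ENNReal.ofReal_le_ofReal (hpt y)
    _ = ENNReal.ofReal (Real.exp (θ * ‖x - z‖ ^ 2)) *
        ENNReal.ofReal (∫ y, bd y ∂(P : Measure 𝒴)) := by
        rw [lintegral_const_mul' _ _ (by simp),
          ofReal_integral_eq_lintegral_ofReal hint (Filter.Eventually.of_forall hbd0)]
    _ ≤ ENNReal.ofReal (Real.exp (θ * ‖x - z‖ ^ 2)) * ENNReal.ofReal
        (Real.exp (-(2 * η * θ * (population P f x - population P f z)) + K)) := by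
        gcongr
    _ = _ := by
        rw [← ENNReal.ofReal_mul (Real.exp_pos _).le, ← Real.exp_add]
        congr 2; ring

end Oracle

/-! ### Trajectories -/

/-- The states visited by the recursion `x ↦ step x (y t)` before each of the `n` inputs. -/
def traj {α 𝒵 : Type*} (step : α → 𝒵 → α) : (n : ℕ) → α → (Fin n → 𝒵) → Fin n → α
  | 0, _, _ => Fin.elim0
  | n + 1, x, y => Fin.cons x (traj step n (step x (y 0)) (Fin.tail y))

/-- The same iteration is viewed as driven by the sampled functions, which exhibits a
sample-function procedure, and by the samples, for measurability and integration. -/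
theorem traj_comp {α 𝒵 𝒲 : Type*} (step : α → 𝒵 → α) (h : 𝒲 → 𝒵) (n : ℕ) (x : α)
    (y : Fin n → 𝒲) :
    traj (fun x w => step x (h w)) n x y = traj step n x (fun t => h (y t)) := by
  induction n generalizing x with
  | zero => rfl
  | succ n ih =>
    rw [traj, traj, ih]
    rfl

theorem traj_induction {α 𝒵 : Type*} {step : α → 𝒵 → α} {p : α → Prop}
    (hp : ∀ x w, p x → p (step x w)) (n : ℕ) {x : α} (hx : p x) (y : Fin n → 𝒵) (i : Fin n) :
    p (traj step n x y i) := by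
  induction n generalizing x with
  | zero => exact i.elim0
  | succ n ih =>
    refine Fin.cases ?_ (fun j => ?_) i
    · simpa [traj] using hx
    · simpa [traj] using ih (hp _ _ hx) (Fin.tail y) j

theorem measurable_traj {α 𝒵 : Type*} [MeasurableSpace α] [MeasurableSpace 𝒵] {step : α → 𝒵 → α}
    (hs : Measurable fun p : α × 𝒵 => step p.1 p.2) (n : ℕ) (i : Fin n) :
    Measurable fun p : α × (Fin n → 𝒵) => traj step n p.1 p.2 i := by
  induction n with
  | zero => exact i.elim0
  | succ n ih =>
    refine Fin.cases ?_ (fun j => ?_) i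
    · simpa [traj] using measurable_fst
    · simp only [traj, Fin.cons_succ]
      have h1 : Measurable fun p : α × (Fin (n + 1) → 𝒵) => step p.1 (p.2 0) :=
        hs.comp (measurable_fst.prodMk ((measurable_pi_apply 0).comp measurable_snd))
      have h2 : Measurable fun p : α × (Fin (n + 1) → 𝒵) => Fin.tail p.2 :=
        measurable_pi_iff.2 fun t => (measurable_pi_apply t.succ).comp measurable_snd
      exact (ih j).comp (h1.prodMk h2)

/-- If `exp Φ` decreases in mean along one step by the factor `exp (K - c)`, then the accumulated
cost `∑ c` has exponential moment at most `exp (Φ x + n K)`. -/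
theorem lintegral_exp_sum_traj_le {α 𝒵 : Type*} [MeasurableSpace α] [MeasurableSpace 𝒵]
    {step : α → 𝒵 → α} (hs : Measurable fun p : α × 𝒵 => step p.1 p.2) {c Φ : α → ℝ}
    (hc : Measurable c) (hΦ : ∀ x, 0 ≤ Φ x) {p : α → Prop} (hp : ∀ x w, p x → p (step x w))
    (P : Measure 𝒵) [IsProbabilityMeasure P] {K : ℝ}
    (hstep : ∀ x, p x → ∫⁻ w, ENNReal.ofReal (Real.exp (Φ (step x w))) ∂P ≤
      ENNReal.ofReal (Real.exp (Φ x - c x + K))) (n : ℕ) {x : α} (hx : p x) :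
    ∫⁻ y, ENNReal.ofReal (Real.exp (∑ i, c (traj step n x y i)))
        ∂(Measure.pi fun _ : Fin n => P) ≤
      ENNReal.ofReal (Real.exp (Φ x + n * K)) := by
  induction n generalizing x with
  -- The empty sum has exponential moment 1, so `Φ ≥ 0` is needed here.
  | zero => simpa using hΦ x
  | succ n ih =>
    have hmeas : Measurable fun q : 𝒵 × (Fin n → 𝒵) => ENNReal.ofReal
        (Real.exp (c x + ∑ i, c (traj step n (step x q.1) q.2 i))) := by
      have h1 : ∀ i : Fin n, Measurable fun q : 𝒵 × (Fin n → 𝒵) =>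
          traj step n (step x q.1) q.2 i := fun i =>
        (measurable_traj hs n i).comp
          ((hs.comp (measurable_const.prodMk measurable_fst)).prodMk measurable_snd)
      fun_prop
    -- Split off the first sample: given it, the rest is a trajectory of length `n` from the new
    -- state, to which the induction hypothesis applies.
    have hpres := measurePreserving_piFinSuccAbove (fun _ : Fin (n + 1) => P) 0
    have hsplit : ∫⁻ y, ENNReal.ofReal (Real.exp (∑ i, c (traj step (n + 1) x y i)))
        ∂(Measure.pi fun _ : Fin (n + 1) => P) =
        ∫⁻ q, ENNReal.ofReal (Real.exp (c x + ∑ i, c (traj step n (step x q.1) q.2 i)))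
          ∂(P.prod (Measure.pi fun _ : Fin n => P)) := by
      rw [← hpres.lintegral_comp hmeas]
      refine lintegral_congr fun y => ?_
      rw [Fin.sum_univ_succ]
      rfl
    rw [hsplit, lintegral_prod _ hmeas.aemeasurable]
    calc _ ≤ ∫⁻ w, ENNReal.ofReal (Real.exp (c x + n * K)) *
          ENNReal.ofReal (Real.exp (Φ (step x w))) ∂P := by
          refine lintegral_mono fun w => ?_
          simp only [Real.exp_add (c x), ENNReal.ofReal_mul (Real.exp_pos _).le]
          rw [lintegral_const_mul' _ _ (by simp), mul_assoc]
          gcongr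
          refine (ih (hp x w hx)).trans_eq ?_
          rw [← ENNReal.ofReal_mul (Real.exp_pos _).le, ← Real.exp_add, add_comm]
      _ ≤ ENNReal.ofReal (Real.exp (c x + n * K)) *
          ENNReal.ofReal (Real.exp (Φ x - c x + K)) := by
          rw [lintegral_const_mul' _ _ (by simp)]
          gcongr
          exact hstep x hx
      _ = _ := by
          rw [← ENNReal.ofReal_mul (Real.exp_pos _).le, ← Real.exp_add]
          congr 2
          push_cast
          ring

/-- Markov's inequality at the level `exp(M + log(1/δ)) = exp(M)/δ`. -/
theorem measure_le_of_lintegral_exp_le {Ω : Type*} [MeasurableSpace Ω] (μ : Measure Ω)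
    [IsProbabilityMeasure μ] {g : Ω → ℝ} (hg : Measurable g) {M δ : ℝ} (hδ : 0 < δ)
    (h : ∫⁻ ω, ENNReal.ofReal (Real.exp (g ω)) ∂μ ≤ ENNReal.ofReal (Real.exp M)) :
    ENNReal.ofReal (1 - δ) ≤ μ {ω | g ω ≤ M + Real.log (1 / δ)} := by
  have hm : MeasurableSet {ω | g ω ≤ M + Real.log (1 / δ)} := measurableSet_le hg measurable_const
  set e := ENNReal.ofReal (Real.exp (M + Real.log (1 / δ))) with he
  have h1 := mul_meas_ge_le_lintegral
    (Real.measurable_exp.comp hg).ennreal_ofReal (μ := μ) e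
  have hexp : ENNReal.ofReal (Real.exp M) = e * ENNReal.ofReal δ := by
    rw [he, ← ENNReal.ofReal_mul (Real.exp_pos _).le, Real.exp_add,
      Real.exp_log (by positivity)]
    congr 1
    field_simp
  have h2 : μ {ω | g ω ≤ M + Real.log (1 / δ)}ᶜ ≤ ENNReal.ofReal δ := by
    have hsub : μ {ω | g ω ≤ M + Real.log (1 / δ)}ᶜ ≤
        μ {ω | e ≤ ENNReal.ofReal (Real.exp (g ω))} := by
      refine measure_mono fun ω hω => ?_
      simp only [mem_compl_iff, mem_ofPred_eq, not_le] at hω ⊢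
      exact ENNReal.ofReal_le_ofReal (Real.exp_le_exp.2 hω.le)
    have h3 : e * μ {ω | e ≤ ENNReal.ofReal (Real.exp (g ω))} ≤ e * ENNReal.ofReal δ :=
      (h1.trans h).trans_eq hexp
    refine hsub.trans ((ENNReal.mul_le_mul_iff_right ?_ ENNReal.ofReal_ne_top).1 h3)
    exact (ENNReal.ofReal_pos.2 (Real.exp_pos _)).ne'
  have h4 := prob_add_prob_compl (μ := μ) hm
  rw [ENNReal.ofReal_sub _ hδ.le, ENNReal.ofReal_one, ← h4]
  exact tsub_le_iff_right.2 (by gcongr)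

/-! ### The upper bound -/

section Upper

variable {d : ℕ} {𝒴 : Type*} [MeasurableSpace 𝒴] {𝒳 : Set (E d)} {P : ProbabilityMeasure 𝒴}
  {γ R ε : ℝ} {f : E d → 𝒴 → ℝ}

theorem convexOn_population (hf : IsObjective 𝒳 P γ f) (h𝒳 : Metric.closedBall 0 R ⊆ 𝒳) :
    ConvexOn ℝ (Metric.closedBall 0 R) (population P f) := by
  refine ⟨convex_closedBall 0 R, fun x hx z hz a b ha hb hab => ?_⟩
  have hix := hf.integrable x (h𝒳 hx)
  have hiz := hf.integrable z (h𝒳 hz)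
  have hi := hf.integrable _ (h𝒳 (convex_closedBall 0 R hx hz ha hb hab))
  simp only [population, smul_eq_mul]
  rw [← integral_const_mul, ← integral_const_mul,
    ← integral_add (hix.const_mul a) (hiz.const_mul b)]
  exact integral_mono hi ((hix.const_mul a).add (hiz.const_mul b))
    fun y => (hf.convex y).2 (mem_univ x) (mem_univ z) ha hb hab

theorem measurable_population (hf : IsObjective 𝒳 P γ f) : Measurable (population P f) :=
  ((measurable_uncurry_of_convex hf.measurable hf.convex).stronglyMeasurable.integral_prod_right
    (ν := (P : Measure 𝒴))).measurable

theorem measurable_sgdStep (hf : IsObjective 𝒳 P γ f) (hR : 0 ≤ R) (hε : 0 < ε) (hγ : 0 < γ)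
    (η lam : ℝ) :
    Measurable fun p : E d × 𝒴 => sgdStep R ε γ η lam p.1 (fun x => f x p.2) := by
  have h1 := measurable_oracle hR hε hγ hf.measurable hf.convex
  exact (measurable_radialClip R).comp
    (measurable_fst.sub (((measurable_radialClip lam).comp h1).const_smul η))

/-- The average iterate of clipped projected subgradient descent started at the origin. -/
def sgdAverage (R ε γ η lam : ℝ) (T : ℕ) (φ : Fin T → E d → ℝ) : E d :=
  ∑ i, (T : ℝ)⁻¹ • traj (sgdStep R ε γ η lam) T 0 φ i

theorem norm_traj_sgdStep_le (hR : 0 ≤ R) (η lam : ℝ) (T : ℕ) (φ : Fin T → E d → ℝ) (i : Fin T) :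
    ‖traj (sgdStep R ε γ η lam) T 0 φ i‖ ≤ R :=
  traj_induction (p := fun x : E d => ‖x‖ ≤ R) (fun x φ _ => norm_sgdStep_le hR η lam x φ) T
    (by simpa using hR) φ i

theorem norm_sgdAverage_le (hR : 0 ≤ R) (η lam : ℝ) {T : ℕ} (hT : 1 ≤ T) (φ : Fin T → E d → ℝ) :
    ‖sgdAverage R ε γ η lam T φ‖ ≤ R := by
  have hT0 : (T : ℝ) ≠ 0 := by positivity
  have := (convex_closedBall (0 : E d) R).sum_mem (t := Finset.univ)
    (w := fun _ : Fin T => (T : ℝ)⁻¹) (z := traj (sgdStep R ε γ η lam) T 0 φ)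
    (fun _ _ => by positivity) (by simp [hT0])
    (fun i _ => mem_closedBall_zero_iff.2 (norm_traj_sgdStep_le hR η lam T φ i))
  exact mem_closedBall_zero_iff.1 this

theorem measurable_traj_sgdStep (hf : IsObjective 𝒳 P γ f) (hR : 0 ≤ R) (hε : 0 < ε) (hγ : 0 < γ)
    (η lam : ℝ) (T : ℕ) (i : Fin T) : Measurable fun y : Fin T → 𝒴 =>
      traj (sgdStep R ε γ η lam) T 0 (fun t x => f x (y t)) i := by
  have heq : (fun y : Fin T → 𝒴 => traj (sgdStep R ε γ η lam) T 0 (fun t x => f x (y t)) i) =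
      fun y => traj (fun x w => sgdStep R ε γ η lam x fun x' => f x' w) T 0 y i := by
    funext y
    exact (congrFun (traj_comp (sgdStep R ε γ η lam) (fun w x => f x w) T 0 y) i).symm
  rw [heq]
  exact (measurable_traj (step := fun x w => sgdStep R ε γ η lam x fun x' => f x' w)
    (measurable_sgdStep hf hR hε hγ η lam) T i).comp
    (measurable_const.prodMk measurable_id)

theorem measurable_sgdAverage (hf : IsObjective 𝒳 P γ f) (hR : 0 ≤ R) (hε : 0 < ε) (hγ : 0 < γ)
    (η lam : ℝ) (T : ℕ) : Measurable fun y : Fin T → 𝒴 =>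
      sgdAverage R ε γ η lam T (fun t x => f x (y t)) :=
  Finset.measurable_sum _ fun i _ =>
    (measurable_traj_sgdStep hf hR hε hγ η lam T i).const_smul (T : ℝ)⁻¹

/-- High-probability bound for clipped projected subgradient descent, in terms of its parameters. -/
theorem sgdAverage_gap_le (hf : IsObjective 𝒳 P γ f) (h𝒳 : Metric.closedBall 0 R ⊆ 𝒳)
    (hR : 0 ≤ R) (hε : 0 < ε) (hγ : 0 < γ) {η lam θ : ℝ} (hη : 0 < η)
    (hl : 0 < lam) (hθ : 0 < θ) (hηl : η * lam ≤ R) (hθl : θ * (5 * R * (η * lam)) ≤ 1)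
    {z : E d} (hz : ‖z‖ ≤ R) {K : ℝ}
    (hK : 2 * η * θ * ε + (4 * R * η * θ / lam + θ * η ^ 2 + 25 * θ ^ 2 * R ^ 2 * η ^ 2) *
      (10 * γ ^ 2) ≤ K) {T : ℕ} (hT : 1 ≤ T) {δ r : ℝ} (hδ : 0 < δ)
    (hr : θ * R ^ 2 + T * K + Real.log (1 / δ) ≤ 2 * η * θ * T * r) :
    ENNReal.ofReal (1 - δ) ≤ (Measure.pi fun _ : Fin T => (P : Measure 𝒴))
      {y | population P f (sgdAverage R ε γ η lam T (fun t x => f x (y t))) -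
        population P f z ≤ r} := by
  have hT0 : (0 : ℝ) < T := by exact_mod_cast hT
  have key := lintegral_exp_sum_traj_le (measurable_sgdStep hf hR hε hγ η lam)
    (c := fun x => 2 * η * θ * (population P f x - population P f z))
    (Φ := fun x => θ * ‖x - z‖ ^ 2)
    (((measurable_population hf).sub_const _).const_mul _) (fun x => by positivity)
    (p := fun x => ‖x‖ ≤ R) (fun x w _ => norm_sgdStep_le hR η lam x _) (P : Measure 𝒴)
    (fun x hx => lintegral_exp_sgdStep_le hf h𝒳 hR hε hγ hη hl hθ hηl hθl hx hz hK) T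
    (x := 0) (by simpa using hR)
  have hcomp : ∀ y : Fin T → 𝒴,
      traj (fun x w => sgdStep R ε γ η lam x (fun x' => f x' w)) T 0 y =
        traj (sgdStep R ε γ η lam) T 0 (fun t x => f x (y t)) :=
    traj_comp (sgdStep R ε γ η lam) (fun w x => f x w) T 0
  simp only [hcomp] at key
  refine (measure_le_of_lintegral_exp_le _ (Finset.measurable_sum _ fun i _ =>
    (((measurable_population hf).sub_const _).const_mul _).comp
      (measurable_traj_sgdStep hf hR hε hγ η lam T i)) hδ key).trans (measure_mono fun y hy => ?_)
  simp only [mem_ofPred_eq, Function.comp_apply] at hy ⊢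
  set X := traj (sgdStep R ε γ η lam) T 0 (fun t x => f x (y t)) with hX
  -- Jensen: the gap of the average is at most the average gap. All iterates lie in the ball, where
  -- the population objective is known to be convex.
  have hjen := (convexOn_population hf h𝒳).map_sum_le (t := Finset.univ)
    (w := fun _ : Fin T => (T : ℝ)⁻¹) (p := X)
    (fun _ _ => by positivity) (by simp [hT0.ne'])
    (fun i _ => mem_closedBall_zero_iff.2 (norm_traj_sgdStep_le hR η lam T _ i))
  rw [← Finset.mul_sum, Finset.sum_sub_distrib] at hy
  simp only [smul_eq_mul, ← Finset.mul_sum] at hjen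
  simp only [Finset.sum_const, Finset.card_univ, Fintype.card_fin, nsmul_eq_mul] at hy
  have hz2 : θ * ‖(0 : E d) - z‖ ^ 2 ≤ θ * R ^ 2 := by
    rw [zero_sub, norm_neg]
    gcongr
  have h1 : 2 * η * θ * (∑ i, population P f (X i) - T * population P f z) ≤
      2 * η * θ * (T * r) := by linarith
  have h2 := le_of_mul_le_mul_left h1 (by positivity)
  have h3 : (T : ℝ)⁻¹ * (∑ i, population P f (X i) - T * population P f z) ≤
      (T : ℝ)⁻¹ * (T * r) := mul_le_mul_of_nonneg_left h2 (by positivity)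
  rw [inv_mul_cancel_left₀ hT0.ne', mul_sub, inv_mul_cancel_left₀ hT0.ne'] at h3
  exact (sub_le_sub_right hjen _).trans h3

/-- Covers the regime `log(1/δ) > T`, where 0 is output. The oracle at 0 with `ε = γR` bounds the
pointwise difference by `‖v‖R + γR`; since `‖v‖R ≤ (R/γ)‖v‖² + γR`, taking means gives `10 + 2 =
12`. -/
theorem population_zero_sub_le (hf : IsObjective 𝒳 P γ f) (h𝒳 : Metric.closedBall 0 R ⊆ 𝒳)
    (hR : 0 < R) (hγ : 0 < γ) {z : E d} (hz : ‖z‖ ≤ R) :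
    population P f 0 - population P f z ≤ 12 * (γ * R) := by
  have h0𝒳 : (0 : E d) ∈ 𝒳 := h𝒳 (by simpa using hR.le)
  have hz𝒳 : z ∈ 𝒳 := h𝒳 (by simpa using hz)
  have hε : 0 < γ * R := mul_pos hγ hR
  set v : 𝒴 → E d := fun y => oracle R (γ * R) γ (fun x => f x y) 0
  have hi : Integrable (fun y => R / γ * ‖v y‖ ^ 2) (P : Measure 𝒴) :=
    (integrable_oracle_sq hf hR.le hε hγ h0𝒳).const_mul _
  have hpt : ∀ y, f 0 y - f z y ≤ R / γ * ‖v y‖ ^ 2 + 2 * (γ * R) := by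
    intro y
    have h1 := isApproxSubgradient_oracle hR.le hε hγ (hf.convex y) 0 ⟨z, by simpa using hz⟩
    have h2 := neg_le_of_abs_le (abs_real_inner_le_norm (v y) (z - 0))
    rw [sub_zero] at h1 h2
    have h3 := mul_le_mul_of_nonneg_left hz (norm_nonneg (v y))
    have h4 : ‖v y‖ * R ≤ R / γ * ‖v y‖ ^ 2 + γ * R := by
      have h5 : 0 ≤ R / γ * ((‖v y‖ - γ) ^ 2 + γ * ‖v y‖) := by positivity
      have h6 : R / γ * ((‖v y‖ - γ) ^ 2 + γ * ‖v y‖) =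
          R / γ * ‖v y‖ ^ 2 + γ * R - ‖v y‖ * R := by
        field_simp
        ring
      linarith
    simp only at h1
    linarith
  have h1 : population P f 0 - population P f z ≤
      ∫ y, (R / γ * ‖v y‖ ^ 2 + 2 * (γ * R)) ∂(P : Measure 𝒴) := by
    rw [population, population,
      ← integral_sub (hf.integrable 0 h0𝒳) (hf.integrable z hz𝒳)]
    exact integral_mono ((hf.integrable 0 h0𝒳).sub (hf.integrable z hz𝒳))
      (hi.add (integrable_const _)) hpt
  rw [integral_add hi (integrable_const _), integral_const_mul] at h1
  have h2 := mul_le_mul_of_nonneg_left (integral_oracle_sq_le hf hR.le hε hγ h0𝒳)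
    (by positivity : 0 ≤ R / γ)
  have h3 : R / γ * (10 * γ ^ 2) = 10 * (γ * R) := by field_simp
  simp only [integral_const, probReal_univ, smul_eq_mul, one_mul] at h1
  linarith

theorem optGap_eq_of_isMinOn {z : E d} (hz : z ∈ 𝒳) (hmin : IsMinOn (population P f) 𝒳 z) (x : E d) :
    optGap 𝒳 P f x = population P f x - population P f z := by
  have : sInf (population P f '' 𝒳) = population P f z := by
    refine IsLeast.csInf_eq ⟨mem_image_of_mem _ hz, ?_⟩
    rintro _ ⟨x, hx, rfl⟩
    exact hmin hx
  exact congrArg (population P f x - ·) this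

theorem quantile_le {Ω : Type*} [MeasurableSpace Ω] {δ : ℝ} {μ : Measure Ω} {L : Ω → ℝ} {r : ℝ}
    (hr : 0 ≤ r) (h : ENNReal.ofReal (1 - δ) ≤ μ {ω | L ω ≤ r}) :
    quantile δ μ L ≤ ENNReal.ofReal r :=
  iInf₂_le (⟨r, hr⟩ : ℝ≥0) h |>.trans_eq (ENNReal.ofReal_eq_coe_nnreal hr).symm

theorem minimaxQuantile_sampleProcedures_le (h𝒳 : Metric.closedBall 0 R ⊆ 𝒳) {T : ℕ} (hT : 1 ≤ T)
    (hγ : 0 < γ) (hR : 0 < R) {δ : ℝ} (hδ0 : 0 < δ) (hδ : δ ≤ 1 / 4) :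
    minimaxQuantile 𝒳 𝒴 γ R δ T (sampleProcedures 𝒳 𝒴 γ R T) ≤
      ENNReal.ofReal (58 * rate γ R δ T) := by
  have hT0 : (0 : ℝ) < T := by exact_mod_cast hT
  set L := Real.log (1 / δ) with hL
  -- Since `δ ≤ 1/4 < 1/e`; this lets terms linear in `s = √L` be absorbed into `s²` below.
  have hL1 : 1 ≤ L := by
    rw [hL, Real.le_log_iff_exp_le (by positivity), le_div_iff₀ hδ0]
    nlinarith [Real.exp_one_lt_d9, Real.exp_pos 1]
  have hrate0 : 0 ≤ 58 * rate γ R δ T := by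
    rw [rate]; positivity
  by_cases hLT : L ≤ T
  · set s := Real.sqrt L with hs
    set q := Real.sqrt T with hq
    have hs1 : 1 ≤ s := Real.one_le_sqrt.2 hL1
    have hs0 : 0 < s := by linarith
    have hq0 : 0 < q := Real.sqrt_pos.2 hT0
    have hs2 : s ^ 2 = L := Real.sq_sqrt (by linarith)
    have hq2 : q ^ 2 = T := Real.sq_sqrt hT0.le
    have hrate : rate γ R δ T = γ * R * (s / q) := by
      rw [rate, ← hL, Real.sqrt_div (by linarith), ← hs, ← hq, min_eq_left]
      rw [div_le_one hq0]
      exact Real.sqrt_le_sqrt hLT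
    -- The choice makes `η lam = R/s ≤ R` and `θ · 5R · η lam = 1`, the largest value permitted,
    -- while `T K` is of order `L`. The tolerance `ε` is the target rate itself.
    set η := R / (γ * q) with hη
    set lam := γ * q / s with hlam
    set θ := s / (5 * R ^ 2) with hθ
    set ε := γ * R * s / q with hε
    have hη0 : 0 < η := by positivity
    have hl0 : 0 < lam := by positivity
    have hθ0 : 0 < θ := by positivity
    have hε0 : 0 < ε := by positivity
    have hηl : η * lam = R / s := by rw [hη, hlam]; field_simp
    have hηl1 : η * lam ≤ R := by rw [hηl]; exact div_le_self hR.le hs1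
    have hθl : θ * (5 * R * (η * lam)) ≤ 1 := by
      rw [hηl, hθ]
      exact le_of_eq (by field_simp)
    have hK : 2 * η * θ * ε + (4 * R * η * θ / lam + θ * η ^ 2 + 25 * θ ^ 2 * R ^ 2 * η ^ 2) *
        (10 * γ ^ 2) ≤ 21 * (s ^ 2 / q ^ 2) := by
      have h1 : 2 * η * θ * ε + (4 * R * η * θ / lam + θ * η ^ 2 + 25 * θ ^ 2 * R ^ 2 * η ^ 2) *
          (10 * γ ^ 2) = (92 / 5 * s ^ 2 + 2 * s) / q ^ 2 := by
        rw [hη, hlam, hθ, hε]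
        field_simp
        ring
      rw [h1, ← mul_div_assoc]
      gcongr
      nlinarith
    have hr : θ * R ^ 2 + T * (21 * (s ^ 2 / q ^ 2)) + Real.log (1 / δ) ≤
        2 * η * θ * T * (58 * rate γ R δ T) := by
      have h1 : 2 * η * θ * T * (58 * rate γ R δ T) = 116 / 5 * s ^ 2 := by
        rw [hrate, ← hq2, hη, hθ]
        field_simp
        ring
      have h2 : θ * R ^ 2 = s / 5 := by rw [hθ]; field_simp
      have h3 : T * (21 * (s ^ 2 / q ^ 2)) = 21 * s ^ 2 := by rw [← hq2]; field_simp
      -- It remains that `s/5 + 21s² + s² ≤ (116/5)s²`, which holds as `s ≥ 1`.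
      rw [h1, h2, h3, ← hL, ← hs2]
      nlinarith
    refine iInf₂_le_of_le (fun f y => sgdAverage R ε γ η lam T (fun t x => f x (y t))) ?_ ?_
    · refine ⟨fun p hp => ⟨measurable_sgdAverage hp.1 hR.le hε0 hγ η lam T, fun y => ?_⟩,
        fun φ => sgdAverage R ε γ η lam T φ, fun _ _ => rfl⟩
      exact h𝒳 (mem_closedBall_zero_iff.2 (norm_sgdAverage_le hR.le η lam hT _))
    · refine iSup₂_le fun p hp => quantile_le hrate0 ?_
      obtain ⟨hf, z, hz𝒳, hmin, hz⟩ := hp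
      simp only [optGap_eq_of_isMinOn hz𝒳 hmin]
      exact sgdAverage_gap_le hf h𝒳 hR.le hε0 hγ hη0 hl0 hθ0 hηl1 hθl hz hK hT hδ0 hr
  · have hrate : rate γ R δ T = γ * R := by
      rw [rate, ← hL, min_eq_right, mul_one]
      rw [Real.one_le_sqrt, one_le_div hT0]
      linarith
    refine iInf₂_le_of_le (fun _ _ => 0) ?_ ?_
    · exact ⟨fun p _ => ⟨measurable_const, fun _ => h𝒳 (by simpa using hR.le)⟩,
        fun _ => 0, fun _ _ => rfl⟩
    · refine iSup₂_le fun p hp => quantile_le hrate0 ?_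
      obtain ⟨hf, z, hz𝒳, hmin, hz⟩ := hp
      have h1 := population_zero_sub_le hf h𝒳 hR hγ hz
      have h2 : optGap 𝒳 p.1 p.2 0 ≤ 58 * rate γ R δ T := by
        rw [optGap_eq_of_isMinOn hz𝒳 hmin, hrate]
        linarith [mul_pos hγ hR]
      simp only [h2, ofPred_true, measure_univ]
      exact ENNReal.ofReal_le_one.2 (by linarith)

end Upper

/-! ### Comparison of the two classes and conclusion -/

theorem minimaxQuantile_anti {d : ℕ} (𝒳 : Set (E d)) (𝒴 : Type*) [MeasurableSpace 𝒴] (γ R δ : ℝ)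
    (T : ℕ) {𝒜 ℬ : Set ((E d → 𝒴 → ℝ) → (Fin T → 𝒴) → E d)} (h : 𝒜 ⊆ ℬ) :
    minimaxQuantile 𝒳 𝒴 γ R δ T ℬ ≤ minimaxQuantile 𝒳 𝒴 γ R δ T 𝒜 :=
  biInf_mono fun _ hx => h hx

theorem sampleProcedures_subset {d : ℕ} (𝒳 : Set (E d)) (𝒴 : Type*) [MeasurableSpace 𝒴] (γ R : ℝ)
    (T : ℕ) : sampleProcedures 𝒳 𝒴 γ R T ⊆ procedures 𝒳 𝒴 γ R T := fun _ hx => hx.1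

end StochOpt

end

theorem mainTheorem12 :
    ∃ c C : ℝ, 0 < c ∧ 0 < C ∧
      ∀ (d : ℕ) (_ : 1 ≤ d) (𝒴 : Type*) [MeasurableSpace 𝒴] (T : ℕ) (_ : 1 ≤ T)
        (γ R δ : ℝ) (_ : 0 < γ) (_ : 0 < R) (_ : 0 < δ) (_ : δ ≤ 1 / 4)
        (𝒳 : Set (EuclideanSpace ℝ (Fin d))) (_ : IsClosed 𝒳) (_ : Convex ℝ 𝒳)
        (_ : Metric.closedBall 0 R ⊆ 𝒳),
        ∀ 𝒜 ∈ ({StochOpt.procedures 𝒳 𝒴 γ R T, StochOpt.sampleProcedures 𝒳 𝒴 γ R T} :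
            Set (Set ((EuclideanSpace ℝ (Fin d) → 𝒴 → ℝ) →
              (Fin T → 𝒴) → EuclideanSpace ℝ (Fin d)))),
          ((∃ S : Set 𝒴, MeasurableSet S ∧ S.Nonempty ∧ Sᶜ.Nonempty) →
            ENNReal.ofReal (c * StochOpt.rate γ R δ T) ≤
              StochOpt.minimaxQuantile 𝒳 𝒴 γ R δ T 𝒜) ∧
          StochOpt.minimaxQuantile 𝒳 𝒴 γ R δ T 𝒜 ≤
            ENNReal.ofReal (C * StochOpt.rate γ R δ T) := by
  refine ⟨1 / 8, 58, by norm_num, by norm_num, ?_⟩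
  intro d hd 𝒴 _ T hT γ R δ hγ hR hδ0 hδ 𝒳 _ _ h𝒳 𝒜 h𝒜
  have hanti := fun {𝒜 ℬ} h => StochOpt.minimaxQuantile_anti (d := d) 𝒳 𝒴 γ R δ T
    (𝒜 := 𝒜) (ℬ := ℬ) h
  have hsub := StochOpt.sampleProcedures_subset 𝒳 𝒴 γ R T
  have h𝒜sub : 𝒜 ⊆ StochOpt.procedures 𝒳 𝒴 γ R T := by
    rcases h𝒜 with rfl | rfl
    exacts [subset_rfl, hsub]
  have hsub𝒜 : StochOpt.sampleProcedures 𝒳 𝒴 γ R T ⊆ 𝒜 := by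
    rcases h𝒜 with rfl | rfl
    exacts [hsub, subset_rfl]
  -- The lower bound is proved for the larger class and the upper bound for the smaller one;
  -- monotonicity transfers both to either class.
  exact ⟨fun hS => (StochOpt.minimaxQuantile_procedures_ge hd hT hγ hR hδ0 hδ h𝒳 hS).trans
      (hanti h𝒜sub),
    (hanti hsub𝒜).trans (StochOpt.minimaxQuantile_sampleProcedures_le h𝒳 hT hγ hR hδ0 hδ)⟩
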